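/- Let $\nu>-1$ and $0<q<1$. Put $(a;q)_n=\prod_{k=1}^{n}(1-aq^{k-1})$, $(a;q)_\infty=\prod_{k\ge1}(1-aq^{k-1})$, $c_\nu(q)=(q;q)_\infty/(q^{\nu+1};q)_\infty$, and let $$J_\nu^{(2)}(z;q)=\frac{(q^{\nu+1};q)_\infty}{(q;q)_\infty}\sum_{n\ge0}\frac{(-1)^n (z/2)^{2n+\nu}}{(q;q)_n(q^{\nu+1};q)_n}\,q^{n(n+\nu)}$$ be the Jackson $q$-Bessel function. For an analytic function $f$ with $f(0)=f'(0)-1=0$, the radius of starlikeness is $$r^*(f)=\sup\left\{r>0 : \operatorname{Re}\frac{zf'(z)}{f(z)}>0\ \text{for all } |z|<r\right\},$$ where the quotient is read as its limit $1$ at $z=0$. Let $g_\nu^{(2)}(z;q)=2^\nu c_\nu(q)z^{1-\nu}J_\nu^{(2)}(z;q)$. Then $r^*=r^*\big(g_\nu^{(2)}(\cdot;q)\big)$ is the smallest positive root of the equation $$r\,\frac{dJ_\nu^{(2)}(r;q)}{dr}-(\nu-1)J_\nu^{(2)}(r;q)=0,$$ and, writing $d_\nu(q)=9q-9q^{\nu+2}+q^{\nu+3}-10q^2+9$,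 it satisfies $$2\sqrt{\frac{(q^{\nu+1}-1)(q-1)}{3q^{\nu+1}}}<r^*<2\sqrt{\frac{3(q^{\nu+1}-1)(q^{\nu+2}-1)(1-q^2)}{q^{\nu+1}d_\nu(q)}}$$ and $$2\sqrt[4]{\frac{(q^{\nu+1}-1)^2(1-q^{\nu+2})(q-1)^2(q+1)}{q^{2\nu+2}d_\nu(q)}}<r^*<\frac23\sqrt{\frac{3(1-q^{\nu+1})(q^{\nu+3}-1)(q-1)}{(q+1)q^{\nu+1}}\,q_1^*(\nu)},$$ where $$q_1^*(\nu)=\frac{(q^3+2q^2+2q+1)\,d_\nu(q)}{a_\nu(q)+b_\nu(q)},$$ $$a_\nu(q)=-9q^{\nu+2}-12q^{\nu+3}-21q^{\nu+4}+3q^{\nu+5}+6q^{\nu+6}+q^{\nu+7}+9q^{2\nu+5}+3q^{2\nu+6},$$ $$b_\nu(q)=3q^{2\nu+7}+q^{2\nu+8}+18q+3q^2-6q^3-15q^4+7q^6+9.$$ -/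

import Mathlib

noncomputable section

namespace QBessel

/-- The finite `q`-shifted factorial `(a;q)_n = ∏_{k=1}^{n} (1 - a q^{k-1})`. -/
def qPoch (a q : ℝ) (n : ℕ) : ℝ :=
  ∏ k ∈ Finset.range n, (1 - a * q ^ k)

/-- The infinite `q`-shifted factorial `(a;q)_∞ = ∏_{k≥1} (1 - a q^{k-1})`. -/
def qPochInf (a q : ℝ) : ℝ :=
  ∏' k : ℕ, (1 - a * q ^ k)

/-- The Jackson `q`-Bessel function `J_ν^{(2)}(z;q)`, with principal values of the powers. -/
def J2 (ν q : ℝ) (z : ℂ) : ℂ :=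
  ((qPochInf (q ^ (ν + 1)) q / qPochInf q q : ℝ) : ℂ) *
    ∑' n : ℕ, (-1) ^ n * (z / 2) ^ (2 * (n : ℂ) + (ν : ℂ)) /
      ((qPoch q q n : ℂ) * (qPoch (q ^ (ν + 1)) q n : ℂ)) *
      ((q ^ ((n : ℝ) * ((n : ℝ) + ν)) : ℝ) : ℂ)

/-- The constant `c_ν(q) = (q;q)_∞ / (q^{ν+1};q)_∞`. -/
def c (ν q : ℝ) : ℝ :=
  qPochInf q q / qPochInf (q ^ (ν + 1)) q

/-- The normalized function `g_ν^{(2)}(z;q) = 2^ν c_ν(q) z^{1-ν} J_ν^{(2)}(z;q)`. The principal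
branches of `z^{1-ν}` and of the powers in `J_ν^{(2)}` combine to odd integer powers of `z`, so
this is the entire function `∑ (-1)^n q^{n(n+ν)} z^{2n+1} / (2^{2n} (q;q)_n (q^{ν+1};q)_n)`. -/
def g2 (ν q : ℝ) (z : ℂ) : ℂ :=
  (((2 : ℝ) ^ ν * c ν q : ℝ) : ℂ) * z ^ (1 - (ν : ℂ)) * J2 ν q z

/-- The radius of starlikeness: the supremum of the `r > 0` such that `f` is analytic in the disk
`|z| < r` and `Re (z f'(z) / f(z)) > 0` there. At `z = 0` the quotient is a removable `0 / 0` (with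
value `1` if `f 0 = 0` and `f' 0 = 1`), so that point is left out. At any other zero of `f`, where
the quotient has a pole, Lean's division gives `0`, so the condition fails, as it should. -/
def radiusOfStarlikeness (f : ℂ → ℂ) : ℝ :=
  sSup {r : ℝ | 0 < r ∧ DifferentiableOn ℂ f (Metric.ball 0 r) ∧
    ∀ z ∈ Metric.ball (0 : ℂ) r, z ≠ 0 → 0 < (z * deriv f z / f z).re}

/-- `9q - 9q^{ν+2} + q^{ν+3} - 10q² + 9`. -/
def d (ν q : ℝ) : ℝ :=
  9 * q - 9 * q ^ (ν + 2) + q ^ (ν + 3) - 10 * q ^ 2 + 9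

/-- The expression `a_ν(q)` in the second upper bound. -/
def a (ν q : ℝ) : ℝ :=
  -9 * q ^ (ν + 2) - 12 * q ^ (ν + 3) - 21 * q ^ (ν + 4) + 3 * q ^ (ν + 5)
    + 6 * q ^ (ν + 6) + q ^ (ν + 7) + 9 * q ^ (2 * ν + 5) + 3 * q ^ (2 * ν + 6)

/-- The expression `b_ν(q)` in the second upper bound. -/
def b (ν q : ℝ) : ℝ :=
  3 * q ^ (2 * ν + 7) + q ^ (2 * ν + 8) + 18 * q + 3 * q ^ 2 - 6 * q ^ 3
    - 15 * q ^ 4 + 7 * q ^ 6 + 9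

/-- The expression `q₁*(ν)` in the second upper bound. -/
def q1star (ν q : ℝ) : ℝ :=
  (q ^ 3 + 2 * q ^ 2 + 2 * q + 1) * d ν q / (a ν q + b ν q)

end QBessel

end

/-! Put w = z²/4 and c_k = `coef ν q k`. Then g(z) = z G(w) with G(w) = ∑ (-1)^k c_k w^k, and g'(z)
= H(w), where H = G + 2wG' has coefficients (-1)^k (2k+1) c_k. Hence z g'/g = H/G = 1 + 2wG'/G. For
a product G = ∏ (1 - y_i w) with y_i > 0, Re(wG'/G) is at least its value at |w| as long as |w| is
below the first zero of G. So the radius is 2√h, where h is the smallest positive zero of H. The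
bounds are the Euler-Rayleigh inequalities 1/T₀ < h < T₀/T₁ and T₁^(-1/2) < h < T₁/T₂ for the power
sums T_k = ∑ y_i^(k+1) of the reciprocal zeros of H; Newton's identities express these by the
coefficients.

No factorization of entire functions is used. G is a limit of q-Laguerre polynomials, whose roots
are positive because of their three-term recurrence; f ↦ f + 2Xf' preserves this, so H is such a
limit too (`IsLimit`). In `exists_first_zero` the power sums converge, the largest reciprocal root
converges along a subsequence to some Z, and h = 1/Z. Equality could survive the limit only for (1 -
Zw)^m exp(-cw), which `not_recursion` excludes by the decay of the coefficients. -/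

namespace RealRooted

/-! ### Polynomials with only positive roots -/

open Polynomial Filter Topology

/-- A real polynomial with constant term `1` all of whose complex roots are positive reals is a
product of factors `1 - y X` with `y > 0`. -/
theorem exists_eq_prod_of_roots_pos (f : ℝ[X]) (h0 : f.coeff 0 = 1)
    (h : ∀ z : ℂ, aeval z f = 0 → ∃ x : ℝ, 0 < x ∧ z = x) :
    ∃ (n : ℕ) (y : Fin n → ℝ), (∀ i, 0 < y i) ∧ f = ∏ i, (1 - C (y i) * X) := by
  induction hm : f.natDegree generalizing f with
  | zero =>
    refine ⟨0, Fin.elim0, fun i => i.elim0, ?_⟩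
    rw [eq_C_of_natDegree_eq_zero hm, h0]
    simp
  | succ m ih =>
    have hdeg : f.degree ≠ 0 := by
      intro hd
      have h' : f.natDegree = 0 := natDegree_eq_of_degree_eq_some (n := 0) hd
      omega
    obtain ⟨z, hz⟩ := IsAlgClosed.exists_aeval_eq_zero ℂ f hdeg
    obtain ⟨x, hx, rfl⟩ := h z hz
    have hroot : f.IsRoot x := by
      have : aeval (algebraMap ℝ ℂ x) f = 0 := hz
      rw [aeval_algebraMap_apply] at this
      simpa using this
    obtain ⟨g, hg⟩ := dvd_iff_isRoot.mpr hroot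
    -- Both factors of (X - x) g are rescaled so that each has constant term 1, as the induction
    -- requires.
    have hf : f = (1 - C x⁻¹ * X) * (-C x * g) := by
      have : (C x : ℝ[X]) * C x⁻¹ = 1 := by rw [← C_mul, mul_inv_cancel₀ hx.ne', C_1]
      rw [hg]
      linear_combination (-X * g) * this
    have hdeg1 : (1 - C x⁻¹ * X : ℝ[X]).natDegree = 1 := by
      have : (1 - C x⁻¹ * X : ℝ[X]) = C (-x⁻¹) * X + C 1 := by simp; ring
      rw [this]
      exact natDegree_linear (by simpa using hx.ne')
    have hne : (-C x * g) ≠ 0 := by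
      rintro h'
      rw [h', mul_zero] at hf
      simp [hf] at h0
    obtain ⟨n, y, hy, hprod⟩ := ih (-C x * g)
      (by rw [hf, mul_coeff_zero] at h0; simpa using h0)
      (fun w hw => h w (by rw [hf, map_mul, hw, mul_zero]))
      (by
        rw [hf, natDegree_mul (by intro h'; simp [h'] at hdeg1) hne, hdeg1] at hm
        omega)
    refine ⟨n + 1, Fin.cons x⁻¹ y, ?_, ?_⟩
    · intro i
      refine Fin.cases ?_ (fun j => ?_) i
      · simpa using hx
      · simpa using hy j
    · rw [Fin.prod_univ_succ]
      simp only [Fin.cons_zero, Fin.cons_succ]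
      rw [← hprod, ← hf]

variable {n : ℕ} (y : Fin n → ℝ)

theorem aeval_prod {K : Type*} [Field K] [Algebra ℝ K] (z : K) :
    aeval z (∏ i, (1 - C (y i) * X)) = ∏ i, (1 - algebraMap ℝ K (y i) * z) := by
  simp [map_prod]

/-- The logarithmic derivative of `∏ (1 - y X)`. -/
theorem aeval_X_mul_derivative_prod {K : Type*} [Field K] [Algebra ℝ K] (z : K)
    (hz : ∀ i, 1 - algebraMap ℝ K (y i) * z ≠ 0) :
    aeval z (X * derivative (∏ i, (1 - C (y i) * X))) =
      -(∏ i, (1 - algebraMap ℝ K (y i) * z)) *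
        ∑ i, algebraMap ℝ K (y i) * z / (1 - algebraMap ℝ K (y i) * z) := by
  have key : ∀ s : Finset (Fin n), aeval z (X * derivative (∏ i ∈ s, (1 - C (y i) * X))) =
      -(∏ i ∈ s, (1 - algebraMap ℝ K (y i) * z)) *
        ∑ i ∈ s, algebraMap ℝ K (y i) * z / (1 - algebraMap ℝ K (y i) * z) := by
    intro s
    induction s using Finset.induction_on with
    | empty => simp
    | insert i s hi ih =>
      rw [Finset.prod_insert hi, Finset.prod_insert hi, Finset.sum_insert hi, derivative_mul,
        mul_add, map_add]
      have h1 : aeval z (X * ((1 - C (y i) * X) * derivative (∏ j ∈ s, (1 - C (y j) * X)))) =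
          (1 - algebraMap ℝ K (y i) * z) *
            aeval z (X * derivative (∏ j ∈ s, (1 - C (y j) * X))) := by
        simp only [map_mul, map_sub, map_one, aeval_C, aeval_X]
        ring
      rw [h1, ih]
      simp only [map_mul, map_sub, map_one, aeval_C, aeval_X, map_sub, derivative_one,
        derivative_mul, derivative_C, derivative_X, map_prod, map_add, map_zero, zero_mul]
      have hcancel : (algebraMap ℝ K) (y i) * z / (1 - (algebraMap ℝ K) (y i) * z) *
          (1 - (algebraMap ℝ K) (y i) * z) = (algebraMap ℝ K) (y i) * z :=
        div_mul_cancel₀ _ (hz i)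
      linear_combination (∏ j ∈ s, (1 - algebraMap ℝ K (y j) * z)) * hcancel
  exact key Finset.univ

/-- For u = y z with y > 0 this has the sign of Im z, so the terms of a logarithmic derivative
cannot cancel off the real axis. -/
theorem im_div_one_sub (u : ℂ) : (u / (1 - u)).im = u.im / Complex.normSq (1 - u) := by
  rw [Complex.div_im]
  simp
  ring

/-- Since u/(1-u) = 1/(1-u) - 1 and |1-u| ≥ 1-|u|. Applied to each factor, it reduces a statement on
a disk to one on the positive axis. -/
theorem re_div_one_sub_le (u : ℂ) (hu : ‖u‖ < 1) : (u / (1 - u)).re ≤ ‖u‖ / (1 - ‖u‖) := by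
  have h1 : 1 - ‖u‖ ≤ ‖1 - u‖ := by
    simpa using norm_sub_norm_le (1 : ℂ) u
  have h2 : (1 - u) ≠ 0 := by
    intro h
    rw [h, norm_zero] at h1
    linarith
  have h3 : u / (1 - u) = (1 - u)⁻¹ - 1 := by field_simp; ring
  have h4 : ‖u‖ / (1 - ‖u‖) = (1 - ‖u‖)⁻¹ - 1 := by
    have : 1 - ‖u‖ ≠ 0 := by linarith
    field_simp
    ring
  rw [h3, h4, Complex.sub_re, Complex.one_re]
  have h5 := Complex.re_le_norm (1 - u)⁻¹
  rw [norm_inv] at h5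
  have : ‖1 - u‖⁻¹ ≤ (1 - ‖u‖)⁻¹ := inv_anti₀ (by linarith) h1
  linarith

/-- If all roots of `f` are positive, then so are those of `f + 2 X f'`. -/
theorem roots_pos_add_two_mul (hy : ∀ i, 0 < y i) (z : ℂ)
    (hz : aeval z ((∏ i, (1 - C (y i) * X)) +
      2 * (X * derivative (∏ i, (1 - C (y i) * X)))) = 0) :
    ∃ x : ℝ, 0 < x ∧ z = x := by
  by_cases hcase : ∃ x : ℝ, 0 < x ∧ z = x
  · exact hcase
  exfalso
  have hne : ∀ i, 1 - algebraMap ℝ ℂ (y i) * z ≠ 0 := by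
    intro i h
    apply hcase
    refine ⟨(y i)⁻¹, inv_pos.mpr (hy i), ?_⟩
    have hyi : (y i : ℂ) ≠ 0 := by exact_mod_cast (hy i).ne'
    have h' : (1 : ℂ) = y i * z := by
      simpa [sub_eq_zero] using h
    rw [Complex.ofReal_inv]
    exact eq_inv_of_mul_eq_one_right h'.symm
  rw [map_add, map_mul, aeval_X_mul_derivative_prod y z hne, aeval_prod] at hz
  have hp : ∏ i, (1 - algebraMap ℝ ℂ (y i) * z) ≠ 0 := Finset.prod_ne_zero_iff.mpr fun i _ => hne i
  -- Division by the product leaves an equation for the logarithmic derivative. For real z ≤ 0 its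
  -- right side is nonpositive; for nonreal z its right side has nonzero imaginary part.
  have hsum : (1 : ℂ) = 2 * ∑ i, algebraMap ℝ ℂ (y i) * z / (1 - algebraMap ℝ ℂ (y i) * z) := by
    have h2 : (aeval z (2 : ℝ[X])) = (2 : ℂ) := map_ofNat _ 2
    rw [h2] at hz
    have : (∏ i, (1 - algebraMap ℝ ℂ (y i) * z)) *
      (1 - 2 * ∑ i, algebraMap ℝ ℂ (y i) * z / (1 - algebraMap ℝ ℂ (y i) * z)) = 0 := by
      linear_combination hz
    rcases mul_eq_zero.mp this with h | h
    · exact absurd h hp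
    · linear_combination h
  by_cases him : z.im = 0
  · have hzr : z = (z.re : ℂ) := Complex.ext (Complex.ofReal_re _).symm (by simp [him])
    have hre : z.re ≤ 0 := by
      by_contra hre
      exact hcase ⟨z.re, not_le.mp hre, hzr⟩
    have hR : (1 : ℝ) = 2 * ∑ i, y i * z.re / (1 - y i * z.re) := by
      rw [hzr] at hsum
      simp only [show ∀ r : ℝ, algebraMap ℝ ℂ r = (r : ℂ) from fun _ => rfl, ← Complex.ofReal_mul, ← Complex.ofReal_one,
        ← Complex.ofReal_sub, ← Complex.ofReal_div, ← Complex.ofReal_sum] at hsum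
      exact_mod_cast hsum
    have : ∑ i, y i * z.re / (1 - y i * z.re) ≤ 0 := by
      refine Finset.sum_nonpos fun i _ => div_nonpos_of_nonpos_of_nonneg ?_ ?_
      · exact mul_nonpos_of_nonneg_of_nonpos (hy i).le hre
      · nlinarith [hy i]
    linarith
  · have hI := congrArg Complex.im hsum
    have h2 : ∀ w : ℂ, (2 * w).im = 2 * w.im := by intro w; simp
    rw [h2, Complex.im_sum, Complex.one_im] at hI
    have hterm : ∀ i, (algebraMap ℝ ℂ (y i) * z / (1 - algebraMap ℝ ℂ (y i) * z)).im =
        z.im * (y i / Complex.normSq (1 - algebraMap ℝ ℂ (y i) * z)) := by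
      intro i
      rw [im_div_one_sub]
      simp
      ring
    simp_rw [hterm] at hI
    rw [← Finset.mul_sum] at hI
    have hS : ∑ i, y i / Complex.normSq (1 - algebraMap ℝ ℂ (y i) * z) = 0 := by
      rcases mul_eq_zero.mp hI.symm with h | h
      · norm_num at h
      · exact (mul_eq_zero.mp h).resolve_left him
    have hpos : ∀ i, 0 < y i / Complex.normSq (1 - algebraMap ℝ ℂ (y i) * z) := fun i =>
      div_pos (hy i) (Complex.normSq_pos.mpr (hne i))
    rcases Nat.eq_zero_or_pos n with rfl | hn
    · simp at hsum
    · have : 0 < ∑ i, y i / Complex.normSq (1 - algebraMap ℝ ℂ (y i) * z) :=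
        Finset.sum_pos (fun i _ => hpos i) ⟨⟨0, hn⟩, Finset.mem_univ _⟩
      linarith

/-- Newton's identities for `∏ (1 - y X)`. -/
theorem newton_prod (k : ℕ) :
    ((k : ℝ) + 1) * (∏ i, (1 - C (y i) * X)).coeff (k + 1) =
      -∑ p ∈ Finset.HasAntidiagonal.antidiagonal k,
        (∏ i, (1 - C (y i) * X)).coeff p.1 * ∑ i, y i ^ (p.2 + 1) := by
  -- As a formal power series, 1 - rX has logarithmic derivative -∑ r^(j+1) X^j. Summing over the
  -- factors gives F' = -F · ∑ s_(j+1) X^j, with s_j the power sum of exponent j; its coefficients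
  -- are Newton's identities.
  have hgeo : ∀ r : ℝ, ((1 - C r * X : ℝ[X]) : PowerSeries ℝ) *
      PowerSeries.mk (fun j => r ^ (j + 1)) = PowerSeries.C r := by
    intro r
    ext j
    rcases j with _ | j
    · simp
    · simp [sub_mul, mul_assoc, PowerSeries.coeff_succ_X_mul]
      ring
  have key : ∀ s : Finset (Fin n),
      ((derivative (∏ i ∈ s, (1 - C (y i) * X)) : ℝ[X]) : PowerSeries ℝ) =
      -((∏ i ∈ s, (1 - C (y i) * X) : ℝ[X]) : PowerSeries ℝ) *
        PowerSeries.mk (fun j => ∑ i ∈ s, y i ^ (j + 1)) := by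
    intro s
    induction s using Finset.induction_on with
    | empty =>
      ext
      simp
    | insert i s hi ih =>
      have hmk : PowerSeries.mk (fun j => ∑ l ∈ insert i s, y l ^ (j + 1)) =
          PowerSeries.mk (fun j => y i ^ (j + 1)) +
            PowerSeries.mk (fun j => ∑ l ∈ s, y l ^ (j + 1)) := by
        ext j
        simp [Finset.sum_insert hi]
      rw [Finset.prod_insert hi, hmk, derivative_mul, Polynomial.coe_add, Polynomial.coe_mul,
        Polynomial.coe_mul, ih, Polynomial.coe_mul]
      have hd : ((derivative (1 - C (y i) * X) : ℝ[X]) : PowerSeries ℝ) =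
          -PowerSeries.C (y i) := by
        simp
      rw [hd]
      linear_combination
        (((∏ j ∈ s, (1 - C (y j) * X) : ℝ[X]) : PowerSeries ℝ)) * hgeo (y i)
  have := congrArg (PowerSeries.coeff k) (key Finset.univ)
  rw [neg_mul, map_neg, PowerSeries.coeff_mul, Polynomial.coeff_coe, coeff_derivative] at this
  rw [mul_comm, this]
  simp [Polynomial.coeff_coe]

/-- Y is the reciprocal of the smallest root; Y = 0 stands for the empty product, which has none. -/
theorem exists_max (hy : ∀ i, 0 < y i) :
    ∃ Y : ℝ, 0 ≤ Y ∧ (∀ i, y i ≤ Y) ∧ (0 < Y → ∃ i, y i = Y) := by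
  rcases Nat.eq_zero_or_pos n with rfl | hn
  · exact ⟨0, le_rfl, fun i => i.elim0, fun h => absurd h (lt_irrefl _)⟩
  · have : Nonempty (Fin n) := ⟨⟨0, hn⟩⟩
    obtain ⟨i, hi⟩ := Finite.exists_max y
    exact ⟨y i, (hy i).le, hi, fun _ => ⟨i, rfl⟩⟩

/-- A lower bound for `∏ (1 - y x)` that depends only on `∑ y` and an upper bound for the `y`. -/
theorem rpow_le_prod (hy : ∀ i, 0 < y i) {Y x : ℝ} (hY : 0 < Y) (hle : ∀ i, y i ≤ Y)
    (hxY : Y * x < 1) :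
    (1 - Y * x) ^ ((∑ i, y i) / Y) ≤ ∏ i, (1 - y i * x) := by
  have h1 : 0 < 1 - Y * x := by linarith
  rw [Finset.sum_div, Real.rpow_sum_of_pos h1]
  refine Finset.prod_le_prod (fun i _ => (Real.rpow_pos_of_pos h1 _).le) fun i _ => ?_
  -- Bernoulli's inequality with exponent y/Y ≤ 1. The number of factors drops out, so the bound
  -- survives a limit in which it grows.
  have := rpow_one_add_le_one_add_mul_self (s := -(Y * x)) (p := y i / Y) (by linarith)
    (div_nonneg (hy i).le hY.le) ((div_le_one hY).mpr (hle i))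
  calc (1 - Y * x) ^ (y i / Y) = (1 + -(Y * x)) ^ (y i / Y) := by ring_nf
    _ ≤ 1 + y i / Y * -(Y * x) := this
    _ = 1 - y i * x := by field_simp; ring

theorem prod_le_norm_prod (hy : ∀ i, 0 < y i) (z : ℂ) (hz : ∀ i, y i * ‖z‖ < 1) :
    ∏ i, (1 - y i * ‖z‖) ≤ ‖∏ i, (1 - (y i : ℂ) * z)‖ := by
  rw [norm_prod]
  refine Finset.prod_le_prod (fun i _ => by linarith [hz i]) fun i _ => ?_
  have := norm_sub_norm_le (1 : ℂ) ((y i : ℂ) * z)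
  simpa [abs_of_pos (hy i)] using this

end RealRooted

/-! ### Limits of real-rooted polynomials and the Euler-Rayleigh inequalities -/

namespace RealRooted

open Polynomial Filter Topology

/-- A polynomial evaluated at `z`, with its logarithmic derivative compared to that at `‖z‖`. -/
theorem eval_div_le_re_aeval_div {n : ℕ} (y : Fin n → ℝ) (hy : ∀ i, 0 < y i) (z : ℂ)
    (hz : ∀ i, y i * ‖z‖ < 1) :
    eval ‖z‖ (X * derivative (∏ i, (1 - C (y i) * X))) / eval ‖z‖ (∏ i, (1 - C (y i) * X)) ≤
      (aeval z (X * derivative (∏ i, (1 - C (y i) * X))) /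
        aeval z (∏ i, (1 - C (y i) * X))).re := by
  have hnorm : ∀ i, ‖(y i : ℂ) * z‖ = y i * ‖z‖ := fun i => by simp [abs_of_pos (hy i)]
  have hR : ∀ i, 1 - algebraMap ℝ ℝ (y i) * ‖z‖ ≠ 0 := fun i => by
    have := hz i
    simp only [Algebra.algebraMap_self, RingHom.id_apply]
    linarith
  have hC : ∀ i, 1 - algebraMap ℝ ℂ (y i) * z ≠ 0 := by
    intro i h
    have h1 : (y i : ℂ) * z = 1 := (sub_eq_zero.mp h).symm
    have := hnorm i
    rw [h1, norm_one] at this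
    linarith [hz i]
  rw [← coe_aeval_eq_eval, aeval_X_mul_derivative_prod y _ hR,
    aeval_X_mul_derivative_prod y _ hC, aeval_prod, aeval_prod, neg_mul, neg_mul, neg_div, neg_div,
    mul_div_cancel_left₀ _ (Finset.prod_ne_zero_iff.mpr fun i _ => hR i),
    mul_div_cancel_left₀ _ (Finset.prod_ne_zero_iff.mpr fun i _ => hC i), Complex.neg_re,
    Complex.re_sum]
  refine neg_le_neg (Finset.sum_le_sum fun i _ => ?_)
  have := re_div_one_sub_le ((y i : ℂ) * z) (by rw [hnorm]; exact hz i)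
  rw [hnorm] at this
  exact this

/-- The power series `∑ (-1)^k e_k z^k`. -/
noncomputable def alt (e : ℕ → ℝ) (z : ℂ) : ℂ := ∑' k : ℕ, (-1) ^ k * (e k : ℂ) * z ^ k

/-- The real power series `∑ (-1)^k e_k x^k`. -/
noncomputable def altReal (e : ℕ → ℝ) (x : ℝ) : ℝ := ∑' k : ℕ, (-1) ^ k * e k * x ^ k

theorem alt_ofReal (e : ℕ → ℝ) (x : ℝ) : alt e x = (altReal e x : ℂ) := by
  rw [alt, altReal, Complex.ofReal_tsum]
  push_cast
  rfl

theorem aeval_eq_tsum (f : ℝ[X]) (z : ℂ) : aeval z f = ∑' k : ℕ, (f.coeff k : ℂ) * z ^ k := by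
  rw [aeval_eq_sum_range, tsum_eq_sum (s := Finset.range (f.natDegree + 1))]
  · refine Finset.sum_congr rfl fun k _ => ?_
    rw [Complex.real_smul]
  · intro k hk
    rw [coeff_eq_zero_of_natDegree_lt (by simpa using hk)]
    simp

/-- Tannery's theorem, dominated by |u k| (‖w‖ + 1)^k. The evaluation point may move with N, which
is needed to carry roots to the limit. -/
theorem tendsto_aeval {u : ℕ → ℝ} {t : ℕ → ℕ → ℝ} {f : ℕ → ℝ[X]}
    (hu : ∀ R : ℝ, 0 ≤ R → Summable fun k => |u k| * R ^ k)
    (ht : ∀ N k, |t N k| ≤ 1) (htl : ∀ k, Tendsto (fun N => t N k) atTop (𝓝 1))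
    (hf : ∀ N k, (f N).coeff k = (-1) ^ k * t N k * u k)
    {l : Filter ℕ} (hl : l ≤ atTop) {z : ℕ → ℂ} {w : ℂ} (hz : Tendsto z l (𝓝 w)) :
    Tendsto (fun N => aeval (z N) (f N)) l (𝓝 (alt u w)) := by
  simp_rw [aeval_eq_tsum, hf]
  refine tendsto_tsum_of_dominated_convergence (hu (‖w‖ + 1) (by positivity)) (fun k => ?_) ?_
  · have h1 : Tendsto (fun N => ((t N k : ℝ) : ℂ)) l (𝓝 ((1 : ℝ) : ℂ)) :=
      (Complex.continuous_ofReal.tendsto _).comp ((htl k).mono_left hl)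
    have h2 := ((h1.const_mul ((-1 : ℂ) ^ k)).mul_const (u k : ℂ)).mul (hz.pow k)
    simpa using h2
  · filter_upwards [hz.norm.eventually_lt_const (lt_add_one ‖w‖)] with N hN k
    simp only [Complex.ofReal_mul, Complex.ofReal_pow, Complex.ofReal_neg, Complex.ofReal_one,
      norm_mul, norm_pow, norm_neg, norm_one, one_pow, one_mul, Complex.norm_real,
      Real.norm_eq_abs]
    have h1 : |t N k| * |u k| ≤ |u k| := mul_le_of_le_one_left (abs_nonneg _) (ht N k)
    have h2 : ‖z N‖ ^ k ≤ (‖w‖ + 1) ^ k := pow_le_pow_left₀ (norm_nonneg _) hN.le k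
    exact mul_le_mul h1 h2 (by positivity) (abs_nonneg _)

/-- The sequence `e` is the limit of the coefficients `t N k * e k`, up to sign, of polynomials
`f N` with only positive roots, and it decreases fast enough for `∑ (-1)^k e_k z^k` not to have an
exponential factor. -/
structure IsLimit (e : ℕ → ℝ) (t : ℕ → ℕ → ℝ) (f : ℕ → ℝ[X]) : Prop where
  zero : e 0 = 1
  pos : ∀ k, 0 < e k
  ratio : Tendsto (fun k : ℕ => ((k : ℝ) + 1) * (e (k + 1) / e k)) atTop (𝓝 0)
  abs_le : ∀ N k, |t N k| ≤ 1
  tendsto : ∀ k, Tendsto (fun N => t N k) atTop (𝓝 1)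
  coeff : ∀ N k, (f N).coeff k = (-1) ^ k * t N k * e k
  prod : ∀ N, ∃ (n : ℕ) (y : Fin n → ℝ), (∀ i, 0 < y i) ∧ f N = ∏ i, (1 - C (y i) * X)

theorem summable_of_ratio {e : ℕ → ℝ} (hpos : ∀ k, 0 < e k)
    (hratio : Tendsto (fun k : ℕ => ((k : ℝ) + 1) * (e (k + 1) / e k)) atTop (𝓝 0))
    (R : ℝ) (hR : 0 ≤ R) : Summable fun k : ℕ => ((k : ℝ) + 1) * e k * R ^ k := by
  -- The ratio test needs nonzero terms; R = 0 is reached by comparison with R + 1.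
  have main : ∀ S : ℝ, 0 < S → Summable fun k : ℕ => ((k : ℝ) + 1) * e k * S ^ k := by
    intro S hS
    have hp : ∀ k : ℕ, 0 < ((k : ℝ) + 1) * e k * S ^ k := fun k => by
      have := hpos k
      positivity
    refine summable_of_ratio_test_tendsto_lt_one (l := 0) zero_lt_one
      (Eventually.of_forall fun k => (hp k).ne') ?_
    have h0 : Tendsto (fun k : ℕ => 1 / ((k : ℝ) + 1)) atTop (𝓝 0) :=
      tendsto_one_div_add_atTop_nhds_zero_nat
    have h1 := (hratio.mul_const S).mul ((h0.const_add 1).mul h0)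
    simp only [zero_mul] at h1
    refine h1.congr fun k => ?_
    have := hpos k
    have := hpos (k + 1)
    rw [Real.norm_of_nonneg (hp _).le, Real.norm_of_nonneg (hp _).le]
    push_cast
    field_simp
    ring
  refine Summable.of_nonneg_of_le (fun k => ?_) (fun k => ?_) (main (R + 1) (by linarith))
  · have := hpos k
    positivity
  · have := hpos k
    gcongr
    linarith

namespace IsLimit

variable {e : ℕ → ℝ} {t : ℕ → ℕ → ℝ} {f : ℕ → ℝ[X]}

theorem summable_nat_mul (h : IsLimit e t f) (R : ℝ) (hR : 0 ≤ R) :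
    Summable fun k : ℕ => |(k : ℝ) * e k| * R ^ k := by
  refine Summable.of_nonneg_of_le (fun k => by positivity) (fun k => ?_)
    (summable_of_ratio h.pos h.ratio R hR)
  have := h.pos k
  rw [abs_of_nonneg (by positivity)]
  gcongr
  linarith

theorem summable (h : IsLimit e t f) (R : ℝ) (hR : 0 ≤ R) :
    Summable fun k : ℕ => |e k| * R ^ k := by
  refine Summable.of_nonneg_of_le (fun k => by positivity) (fun k => ?_)
    (summable_of_ratio h.pos h.ratio R hR)
  have := h.pos k
  rw [abs_of_pos this]
  gcongr
  nlinarith [(Nat.cast_nonneg k : (0 : ℝ) ≤ k)]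

theorem coeff_X_mul_derivative (h : IsLimit e t f) (N k : ℕ) :
    (X * derivative (f N)).coeff k = (-1) ^ k * t N k * ((k : ℝ) * e k) := by
  rcases k with _ | k
  · simp
  · rw [coeff_X_mul, coeff_derivative, h.coeff]
    push_cast
    ring

theorem tendsto_eval (h : IsLimit e t f) {l : Filter ℕ} (hl : l ≤ atTop) {x : ℕ → ℝ} {w : ℝ}
    (hx : Tendsto x l (𝓝 w)) : Tendsto (fun N => eval (x N) (f N)) l (𝓝 (altReal e w)) := by
  have h1 := tendsto_aeval h.summable h.abs_le h.tendsto h.coeff hl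
    ((Complex.continuous_ofReal.tendsto _).comp hx)
  rw [alt_ofReal] at h1
  have h2 := (Complex.continuous_re.tendsto _).comp h1
  refine h2.congr fun N => ?_
  have : aeval (algebraMap ℝ ℂ (x N)) (f N) = algebraMap ℝ ℂ (aeval (x N) (f N)) :=
    aeval_algebraMap_apply _ _ _
  exact congrArg Complex.re this

theorem tendsto_eval_X_mul_derivative (h : IsLimit e t f) {l : Filter ℕ} (hl : l ≤ atTop) (x : ℝ) :
    Tendsto (fun N => eval x (X * derivative (f N))) l
      (𝓝 (altReal (fun k => (k : ℝ) * e k) x)) := by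
  have h1 := tendsto_aeval h.summable_nat_mul h.abs_le h.tendsto h.coeff_X_mul_derivative hl
    (tendsto_const_nhds (x := (x : ℂ)))
  rw [alt_ofReal] at h1
  have h2 := (Complex.continuous_re.tendsto _).comp h1
  refine h2.congr fun N => ?_
  have : aeval (algebraMap ℝ ℂ x) (X * derivative (f N)) =
      algebraMap ℝ ℂ (aeval x (X * derivative (f N))) := aeval_algebraMap_apply _ _ _
  exact congrArg Complex.re this

/-- The coefficients cannot satisfy the recursion that holds for `(1 - Y z)^m exp (-c z)`. -/
theorem not_recursion (h : IsLimit e t f) {Y E : ℝ} (hY : 0 ≤ Y)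
    (hrec : ∀ m : ℕ, ((m : ℝ) + 2) * e (m + 2) + Y * ((m : ℝ) + 1) * e (m + 1) =
      e (m + 1) * e 1 + e m * E) : False := by
  have h0 : Tendsto (fun k : ℕ => 1 / ((k : ℝ) + 1)) atTop (𝓝 0) :=
    tendsto_one_div_add_atTop_nhds_zero_nat
  have hr1 : Tendsto (fun m : ℕ => ((m : ℝ) + 2) * (e (m + 2) / e (m + 1))) atTop (𝓝 0) := by
    refine (h.ratio.comp (tendsto_add_atTop_nat 1)).congr fun m => ?_
    simp only [Function.comp]
    push_cast
    ring
  have hr0 : Tendsto (fun m : ℕ => e (m + 1) / e m) atTop (𝓝 0) := by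
    have := h.ratio.mul h0
    rw [zero_mul] at this
    refine this.congr fun m => ?_
    field_simp
  -- For (1 - Yz)^m exp(-cz) one has E = cY. After division by `e m` every other term tends to 0.
  have hE : E = 0 := by
    have hlim : Tendsto (fun m : ℕ => ((m : ℝ) + 2) * (e (m + 2) / e (m + 1)) * (e (m + 1) / e m) +
        Y * (((m : ℝ) + 1) * (e (m + 1) / e m)) - e 1 * (e (m + 1) / e m)) atTop
        (𝓝 (0 * 0 + Y * 0 - e 1 * 0)) :=
      ((hr1.mul hr0).add (h.ratio.const_mul Y)).sub (hr0.const_mul _)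
    have hconst : Tendsto (fun _ : ℕ => E) atTop (𝓝 (0 * 0 + Y * 0 - e 1 * 0)) := by
      refine hlim.congr fun m => ?_
      have h1 := (h.pos m).ne'
      have h2 := (h.pos (m + 1)).ne'
      field_simp
      linear_combination hrec m
    simpa using tendsto_nhds_unique tendsto_const_nhds hconst
  -- If Y = 0, the left side tends to 0 although `e 1` is positive; if Y > 0, it is unbounded
  -- although `e 1` is fixed.
  have hrel : ∀ m : ℕ, ((m : ℝ) + 2) * (e (m + 2) / e (m + 1)) + Y * ((m : ℝ) + 1) = e 1 := by
    intro m
    have h2 := (h.pos (m + 1)).ne'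
    have := hrec m
    rw [hE] at this
    field_simp
    linear_combination this
  rcases hY.eq_or_lt with hY0 | hY0
  · have : Tendsto (fun _ : ℕ => e 1) atTop (𝓝 0) := by
      refine hr1.congr fun m => ?_
      rw [← hrel m, ← hY0]
      ring
    exact (h.pos 1).ne' (tendsto_nhds_unique tendsto_const_nhds this)
  · obtain ⟨m, hm⟩ := exists_nat_gt (e 1 / Y)
    rw [div_lt_iff₀ hY0] at hm
    have h1 := hrel m
    have h2 : 0 < e (m + 2) / e (m + 1) := div_pos (h.pos _) (h.pos _)
    have h3 : 0 < ((m : ℝ) + 2) * (e (m + 2) / e (m + 1)) := by positivity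
    nlinarith

/-- The smallest zero of `∑ (-1)^k e_k z^k`, with the Euler-Rayleigh inequalities for it. -/
theorem exists_first_zero (h : IsLimit e t f) :
    ∃ r : ℝ, 0 < r ∧ altReal e r = 0 ∧ (∀ x, 0 ≤ x → x < r → 0 < altReal e x) ∧
      1 < r * e 1 ∧ 1 < r ^ 2 * (e 1 ^ 2 - 2 * e 2) ∧
      r * (e 1 ^ 2 - 2 * e 2) < e 1 ∧
      r * (e 1 ^ 3 - 3 * e 1 * e 2 + 3 * e 3) < e 1 ^ 2 - 2 * e 2 ∧
      0 < e 1 ^ 3 - 3 * e 1 * e 2 + 3 * e 3 ∧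
      ∀ z : ℂ, ‖z‖ < r → altReal e ‖z‖ ≤ ‖alt e z‖ ∧
        altReal (fun k => (k : ℝ) * e k) ‖z‖ / altReal e ‖z‖ ≤
          (alt (fun k => (k : ℝ) * e k) z / alt e z).re := by
  choose n y hy hf using h.prod
  choose Y hY0 hYle hYeq using fun N => exists_max (y N) (hy N)
  -- The index is shifted: `s N k` is the power sum of exponent k + 1, and likewise for its limit `T
  -- k`.
  set s : ℕ → ℕ → ℝ := fun N k => ∑ i, y N i ^ (k + 1) with hs
  have hnewton : ∀ N k : ℕ, ((k : ℝ) + 1) * (f N).coeff (k + 1) =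
      -∑ p ∈ Finset.HasAntidiagonal.antidiagonal k, (f N).coeff p.1 * s N p.2 := by
    intro N k
    have := newton_prod (y N) k
    rwa [← hf N] at this
  have hcoeff : ∀ k, Tendsto (fun N => (f N).coeff k) atTop (𝓝 ((-1) ^ k * e k)) := by
    intro k
    simp_rw [h.coeff]
    simpa using ((h.tendsto k).const_mul ((-1) ^ k)).mul_const (e k)
  have hc0 : ∀ N, (f N).coeff 0 = 1 := by
    intro N
    rw [hf N, coeff_zero_eq_eval_zero, eval_prod]
    simp
  -- Newton's identity solves for each power sum in terms of the convergent coefficients and the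
  -- earlier power sums.
  have hTex : ∀ k, ∃ T, Tendsto (fun N => s N k) atTop (𝓝 T) := by
    intro k
    induction k using Nat.strong_induction_on with
    | _ k ih =>
      rcases k with _ | k
      · refine ⟨_, ((hcoeff 1).neg).congr fun N => ?_⟩
        have := hnewton N 0
        simp [hc0] at this
        rw [this, neg_neg]
      · choose! T hT using ih
        have hlim : Tendsto (fun N => -(((k + 1 : ℕ) : ℝ) + 1) * (f N).coeff (k + 1 + 1) -
            ∑ p ∈ Finset.HasAntidiagonal.antidiagonal k, (f N).coeff (p.1 + 1) * s N p.2) atTop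
            (𝓝 (-(((k + 1 : ℕ) : ℝ) + 1) * ((-1) ^ (k + 1 + 1) * e (k + 1 + 1)) -
            ∑ p ∈ Finset.HasAntidiagonal.antidiagonal k,
              (-1) ^ (p.1 + 1) * e (p.1 + 1) * T p.2)) := by
          refine ((hcoeff _).const_mul _).sub (tendsto_finsetSum _ fun p hp => ?_)
          refine (hcoeff _).mul (hT _ ?_)
          have := Finset.HasAntidiagonal.mem_antidiagonal.mp hp
          omega
        refine ⟨_, hlim.congr fun N => ?_⟩
        have := hnewton N (k + 1)
        rw [Finset.Nat.sum_antidiagonal_succ, hc0] at this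
        linear_combination -this
  choose T hT using hTex
  have hTnewton : ∀ k : ℕ, ((k : ℝ) + 1) * ((-1) ^ (k + 1) * e (k + 1)) =
      -∑ p ∈ Finset.HasAntidiagonal.antidiagonal k, (-1) ^ p.1 * e p.1 * T p.2 := by
    intro k
    have h1 := (hcoeff (k + 1)).const_mul ((k : ℝ) + 1)
    have h2 : Tendsto (fun N => -∑ p ∈ Finset.HasAntidiagonal.antidiagonal k,
        (f N).coeff p.1 * s N p.2) atTop
        (𝓝 (-∑ p ∈ Finset.HasAntidiagonal.antidiagonal k, (-1) ^ p.1 * e p.1 * T p.2)) :=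
      (tendsto_finsetSum _ fun p _ => (hcoeff p.1).mul (hT p.2)).neg
    refine tendsto_nhds_unique h1 (h2.congr fun N => ?_)
    rw [hnewton]
  have hT0 : T 0 = e 1 := by
    have := hTnewton 0
    simp [h.zero] at this
    linarith
  have hT1 : T 1 = e 1 ^ 2 - 2 * e 2 := by
    have := hTnewton 1
    simp [Finset.Nat.sum_antidiagonal_succ, h.zero, hT0] at this
    linear_combination this
  have hT2 : T 2 = e 1 ^ 3 - 3 * e 1 * e 2 + 3 * e 3 := by
    have := hTnewton 2
    simp [Finset.Nat.sum_antidiagonal_succ, h.zero, hT0, hT1] at this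
    linear_combination this
  have hspow : ∀ N k, Y N ^ (k + 1) ≤ s N k := by
    intro N k
    rcases (hY0 N).eq_or_lt with h0 | h0
    · rw [← h0, zero_pow (by omega)]
      exact Finset.sum_nonneg fun i _ => pow_nonneg (hy N i).le _
    · obtain ⟨i, hi⟩ := hYeq N h0
      rw [← hi]
      exact Finset.single_le_sum (f := fun i => y N i ^ (k + 1))
        (fun j _ => pow_nonneg (hy N j).le _) (Finset.mem_univ i)
  -- All summands are nonnegative, and raising k by 1 multiplies each of them by some y ≤ Y. Both
  -- facts pass to the limit as `hL0` and `hL1`.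
  have hsdiff : ∀ N k, Y N * s N k - s N (k + 1) = ∑ i, (Y N - y N i) * y N i ^ (k + 1) := by
    intro N k
    simp only [hs]
    rw [Finset.mul_sum, ← Finset.sum_sub_distrib]
    refine Finset.sum_congr rfl fun i _ => ?_
    ring
  have hA0 : ∀ N k, 0 ≤ Y N * s N k - s N (k + 1) := by
    intro N k
    rw [hsdiff]
    exact Finset.sum_nonneg fun i _ =>
      mul_nonneg (sub_nonneg.mpr (hYle N i)) (pow_nonneg (hy N i).le _)
  have hA1 : ∀ N k, Y N * s N (k + 1) - s N (k + 2) ≤ Y N * (Y N * s N k - s N (k + 1)) := by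
    intro N k
    rw [hsdiff, hsdiff, Finset.mul_sum]
    refine Finset.sum_le_sum fun i _ => ?_
    have h1 : 0 ≤ (Y N - y N i) * y N i ^ (k + 1) :=
      mul_nonneg (sub_nonneg.mpr (hYle N i)) (pow_nonneg (hy N i).le _)
    have h2 := mul_le_mul_of_nonneg_right (hYle N i) h1
    calc (Y N - y N i) * y N i ^ (k + 1 + 1) = y N i * ((Y N - y N i) * y N i ^ (k + 1)) := by ring
      _ ≤ _ := h2
  obtain ⟨B, hB⟩ := (hT 0).bddAbove_range
  have hYB : ∀ N, Y N ∈ Set.Icc 0 B := fun N => by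
    refine ⟨hY0 N, le_trans ?_ (hB ⟨N, rfl⟩)⟩
    simpa using hspow N 0
  obtain ⟨Z, hZ, φ, hφ, hlimY⟩ := isCompact_Icc.tendsto_subseq hYB
  have hφt := hφ.tendsto_atTop
  have hTφ : ∀ k, Tendsto (fun N => s (φ N) k) atTop (𝓝 (T k)) := fun k => (hT k).comp hφt
  have hLpow : ∀ k, Z ^ (k + 1) ≤ T k := fun k =>
    le_of_tendsto_of_tendsto' (hlimY.pow (k + 1)) (hTφ k) fun N => hspow _ _
  have hL0 : ∀ k, 0 ≤ Z * T k - T (k + 1) := fun k =>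
    ge_of_tendsto' ((hlimY.mul (hTφ k)).sub (hTφ (k + 1))) fun N => hA0 _ _
  have hL1 : ∀ k, Z * T (k + 1) - T (k + 2) ≤ Z * (Z * T k - T (k + 1)) := fun k =>
    le_of_tendsto_of_tendsto' ((hlimY.mul (hTφ (k + 1))).sub (hTφ (k + 2)))
      (hlimY.mul ((hlimY.mul (hTφ k)).sub (hTφ (k + 1)))) fun N => hA1 _ _
  -- If this defect vanished, `hL1` would make all later ones vanish. The sequence T would be
  -- geometric from `T 1` on, and Newton's identities would collapse to the recursion excluded by
  -- `not_recursion`. The other strict inequalities follow from this one.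
  have hstrict : 0 < Z * T 1 - T 2 := by
    refine (hL0 1).lt_of_ne fun heq => ?_
    have hzero : ∀ k, Z * T (k + 1) - T (k + 2) = 0 := by
      intro k
      induction k with
      | zero => exact heq.symm
      | succ k ih =>
        refine le_antisymm ?_ (hL0 (k + 2))
        have := hL1 (k + 1)
        rw [show k + 1 + 1 = k + 2 from rfl, ih, mul_zero] at this
        exact this
    refine h.not_recursion (Y := Z) (E := Z * T 0 - T 1) hZ.1 fun m => ?_
    have h1 := hTnewton (m + 1)
    have h2 := hTnewton m
    rw [Finset.Nat.sum_antidiagonal_succ'] at h1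
    have h3 : ∑ p ∈ Finset.HasAntidiagonal.antidiagonal m,
        (-1) ^ p.1 * e p.1 * (T (p.2 + 1) - Z * T p.2) = (-1) ^ m * e m * (T 1 - Z * T 0) := by
      rw [Finset.sum_eq_single (m, 0)]
      · rintro ⟨i, j⟩ hij hne
        rcases j with _ | j
        · have := Finset.HasAntidiagonal.mem_antidiagonal.mp hij
          simp only [add_zero] at this
          exact absurd (by rw [this]) hne
        · have := hzero j
          rw [show T (j + 1 + 1) - Z * T (j + 1) = 0 by linarith, mul_zero]
      · intro hnot
        exact absurd (Finset.HasAntidiagonal.mem_antidiagonal.mpr (by simp)) hnot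
    simp_rw [mul_sub] at h3
    rw [Finset.sum_sub_distrib] at h3
    have h4 : ∑ p ∈ Finset.HasAntidiagonal.antidiagonal m, (-1) ^ p.1 * e p.1 * (Z * T p.2) =
        Z * ∑ p ∈ Finset.HasAntidiagonal.antidiagonal m, (-1) ^ p.1 * e p.1 * T p.2 := by
      rw [Finset.mul_sum]
      exact Finset.sum_congr rfl fun p _ => by ring
    rw [h4] at h3
    have h5 : ((-1 : ℝ) ^ m) * (-1) ^ m = 1 := by rw [← mul_pow]; norm_num
    simp only at h1
    rw [hT0] at h1 h3
    push_cast at h1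
    rw [hT0]
    have h6 : (-1 : ℝ) ^ m * (((m : ℝ) + 2) * e (m + 2) + Z * ((m : ℝ) + 1) * e (m + 1)) =
        (-1 : ℝ) ^ m * (e (m + 1) * e 1 + e m * (Z * e 1 - T 1)) := by
      linear_combination h1 - Z * h2 - h3
    exact mul_left_cancel₀ (pow_ne_zero m (by norm_num)) h6
  have hT1nn : 0 ≤ T 1 := le_trans (pow_nonneg hZ.1 _) (hLpow 1)
  have hT2nn : 0 ≤ T 2 := le_trans (pow_nonneg hZ.1 _) (hLpow 2)
  have hZpos : 0 < Z := by
    refine hZ.1.lt_of_ne fun h0 => ?_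
    rw [← h0, zero_mul] at hstrict
    linarith
  have hZ2 : Z ^ 2 < T 1 := by
    refine (hLpow 1).lt_of_ne fun h0 => ?_
    have := hLpow 2
    rw [← h0] at hstrict
    norm_num at hstrict this
    nlinarith
  have hA : T 1 < Z * T 0 := by
    have := hL1 0
    by_contra hcon
    have : Z * (Z * T 0 - T 1) ≤ 0 := by nlinarith
    linarith [hL1 0]
  have hZ1 : Z < T 0 := by
    by_contra hcon
    nlinarith
  have hT2pos : 0 < T 2 := lt_of_lt_of_le (pow_pos hZpos _) (hLpow 2)
  have hsmall : ∀ x, 0 ≤ x → x < Z⁻¹ → ∀ᶠ N in atTop, Y (φ N) * x < 1 ∧ 0 < Y (φ N) := by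
    intro x hx hxZ
    have h1 : Z * x < 1 := by
      have := mul_lt_mul_of_pos_left hxZ hZpos
      rwa [mul_inv_cancel₀ hZpos.ne'] at this
    exact ((hlimY.mul_const x).eventually_lt_const h1).and (hlimY.eventually_const_lt hZpos)
  have hposlt : ∀ x, 0 ≤ x → x < Z⁻¹ → 0 < altReal e x := by
    intro x hx hxZ
    have h1 : 0 < 1 - Z * x := by
      have := mul_lt_mul_of_pos_left hxZ hZpos
      rw [mul_inv_cancel₀ hZpos.ne'] at this
      linarith
    -- The lower bound of `rpow_le_prod` has a positive limit below 1/Z, so no zero can appear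
    -- there.
    have hlim : Tendsto (fun N => (1 - Y (φ N) * x) ^ (s (φ N) 0 / Y (φ N))) atTop
        (𝓝 ((1 - Z * x) ^ (T 0 / Z))) :=
      ((hlimY.mul_const x).const_sub 1).rpow ((hTφ 0).div hlimY hZpos.ne') (Or.inl h1.ne')
    have hlim2 : Tendsto (fun N => eval x (f (φ N))) atTop (𝓝 (altReal e x)) :=
      (h.tendsto_eval le_rfl (tendsto_const_nhds (x := x))).comp hφt
    refine lt_of_lt_of_le (Real.rpow_pos_of_pos h1 _) (le_of_tendsto_of_tendsto hlim hlim2 ?_)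
    filter_upwards [hsmall x hx hxZ] with N hN
    have := rpow_le_prod (y (φ N)) (hy _) hN.2 (hYle _) hN.1
    rw [hf (φ N), eval_prod]
    simpa [hs] using this
  refine ⟨Z⁻¹, inv_pos.mpr hZpos, ?_, hposlt, ?_, ?_, ?_, ?_, ?_, ?_⟩
  -- The polynomials vanish at the moving points 1/Y, which converge to 1/Z.
  · have hlim : Tendsto (fun N => (Y (φ N))⁻¹) atTop (𝓝 Z⁻¹) := hlimY.inv₀ hZpos.ne'
    have hsub : IsLimit e (fun N => t (φ N)) (fun N => f (φ N)) :=
      { zero := h.zero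
        pos := h.pos
        ratio := h.ratio
        abs_le := fun N => h.abs_le _
        tendsto := fun k => (h.tendsto k).comp hφt
        coeff := fun N => h.coeff _
        prod := fun N => h.prod _ }
    have h1 := hsub.tendsto_eval le_rfl hlim
    refine tendsto_nhds_unique h1 (tendsto_const_nhds.congr' ?_)
    filter_upwards [hlimY.eventually_const_lt hZpos] with N hN
    obtain ⟨i, hi⟩ := hYeq _ hN
    rw [hf (φ N), eval_prod]
    refine (Finset.prod_eq_zero (Finset.mem_univ i) ?_).symm
    rw [hi]
    have : Y (φ N) ≠ 0 := ne_of_gt hN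
    simp [this]
  · rw [← hT0, ← div_eq_inv_mul, lt_div_iff₀ hZpos, one_mul]
    exact hZ1
  · rw [← hT1, inv_pow, ← div_eq_inv_mul, lt_div_iff₀ (by positivity), one_mul]
    exact hZ2
  · rw [← hT1, ← hT0, ← div_eq_inv_mul, div_lt_iff₀ hZpos]
    linarith
  · rw [← hT1, ← hT2, ← div_eq_inv_mul, div_lt_iff₀ hZpos]
    linarith
  · rw [← hT2]
    exact hT2pos
  · intro z hz
    have hev := hsmall _ (norm_nonneg z) hz
    have hpx := hposlt _ (norm_nonneg z) hz
    have l1 : Tendsto (fun N => eval ‖z‖ (f (φ N))) atTop (𝓝 (altReal e ‖z‖)) :=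
      (h.tendsto_eval le_rfl (tendsto_const_nhds (x := ‖z‖))).comp hφt
    have l2 : Tendsto (fun N => aeval z (f (φ N))) atTop (𝓝 (alt e z)) :=
      (tendsto_aeval h.summable h.abs_le h.tendsto h.coeff le_rfl
        (tendsto_const_nhds (x := z))).comp hφt
    have l3 : Tendsto (fun N => eval ‖z‖ (X * derivative (f (φ N)))) atTop _ :=
      (h.tendsto_eval_X_mul_derivative le_rfl ‖z‖).comp hφt
    have l4 : Tendsto (fun N => aeval z (X * derivative (f (φ N)))) atTop _ :=
      (tendsto_aeval h.summable_nat_mul h.abs_le h.tendsto h.coeff_X_mul_derivative le_rfl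
        (tendsto_const_nhds (x := z))).comp hφt
    have hlt : ∀ᶠ N in atTop, ∀ i, y (φ N) i * ‖z‖ < 1 := by
      filter_upwards [hev] with N hN i
      exact lt_of_le_of_lt (mul_le_mul_of_nonneg_right (hYle _ i) (norm_nonneg z)) hN.1
    have hle : altReal e ‖z‖ ≤ ‖alt e z‖ := by
      refine le_of_tendsto_of_tendsto l1 l2.norm ?_
      filter_upwards [hlt] with N hN
      have := prod_le_norm_prod (y (φ N)) (hy _) z hN
      rw [hf (φ N), aeval_prod, eval_prod]
      simpa using this
    refine ⟨hle, ?_⟩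
    have hne : alt e z ≠ 0 := norm_pos_iff.mp (lt_of_lt_of_le hpx hle)
    refine le_of_tendsto_of_tendsto (l3.div l1 hpx.ne')
      ((Complex.continuous_re.tendsto _).comp (l4.div l2 hne)) ?_
    filter_upwards [hlt] with N hN
    have := eval_div_le_re_aeval_div (y (φ N)) (hy _) z hN
    rw [← hf (φ N)] at this
    exact this

/-- The power series is entire, with the expected derivative. -/
theorem exists_hasDerivAt_alt (h : IsLimit e t f) (z : ℂ) :
    ∃ D, HasDerivAt (alt e) D z ∧ z * D = alt (fun k => (k : ℝ) * e k) z := by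
  set R := ‖z‖ + 1 with hR
  have hR0 : 0 < R := by positivity
  have hu : Summable fun k : ℕ => |(k : ℝ) * e k| * R ^ k * R⁻¹ :=
    (h.summable_nat_mul R hR0.le).mul_right _
  have hmem : z ∈ Metric.ball (0 : ℂ) R := by simp [hR]
  refine ⟨_, hasDerivAt_tsum_of_isPreconnected (y₀ := 0)
    (g' := fun k w => (-1) ^ k * (e k : ℂ) * ((k : ℂ) * w ^ (k - 1))) hu Metric.isOpen_ball
    (convex_ball (0 : ℂ) R).isPreconnected (fun k w _ => (hasDerivAt_pow k w).const_mul _)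
    (fun k w hw => ?_) (Metric.mem_ball_self hR0) ?_ hmem, ?_⟩
  · have hw' : ‖w‖ ≤ R := by simpa using (Metric.mem_ball.mp hw).le
    rcases k with _ | k
    · simp
    · simp only [norm_mul, norm_pow, norm_neg, norm_one, one_pow, one_mul, Complex.norm_real,
        Real.norm_eq_abs, Complex.norm_natCast, Nat.add_sub_cancel, abs_mul, Nat.abs_cast]
      have : R ^ (k + 1) * R⁻¹ = R ^ k := by
        field_simp
        ring
      rw [mul_assoc (((k + 1 : ℕ) : ℝ) * |e (k + 1)|), this]
      have h1 : ‖w‖ ^ k ≤ R ^ k := pow_le_pow_left₀ (norm_nonneg _) hw' k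
      calc |e (k + 1)| * (((k + 1 : ℕ) : ℝ) * ‖w‖ ^ k)
          = ((k + 1 : ℕ) : ℝ) * |e (k + 1)| * ‖w‖ ^ k := by ring
        _ ≤ _ := by gcongr
  -- At the base point 0 only the term k = 0 is nonzero.
  · refine summable_of_ne_finset_zero (s := {0}) fun k hk => ?_
    simp only [Finset.mem_singleton] at hk
    simp [hk]
  · rw [alt, ← tsum_mul_left]
    refine tsum_congr fun k => ?_
    rcases k with _ | k
    · simp
    · simp only [Nat.add_sub_cancel]
      push_cast
      ring

end IsLimit

end RealRooted

/-! ### q-Laguerre polynomials and their roots -/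

noncomputable section

namespace QBessel

open Polynomial Filter Topology RealRooted

variable {ν q : ℝ}

theorem qPoch_succ (x q : ℝ) (n : ℕ) : qPoch x q (n + 1) = qPoch x q n * (1 - x * q ^ n) :=
  Finset.prod_range_succ _ _

theorem qPoch_zero (x q : ℝ) : qPoch x q 0 = 1 := Finset.prod_range_zero _

theorem qPoch_pos {x : ℝ} (hq0 : 0 < q) (hq1 : q < 1) (hx0 : 0 < x) (hx1 : x < 1) (n : ℕ) :
    0 < qPoch x q n := by
  refine Finset.prod_pos fun k _ => ?_
  have h1 : q ^ k ≤ 1 := pow_le_one₀ hq0.le hq1.le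
  have h2 : 0 < q ^ k := pow_pos hq0 k
  nlinarith

theorem qPoch_inv_succ (hq0 : 0 < q) (Z : ℝ) (k : ℕ) :
    qPoch (q * Z) q⁻¹ (k + 1) = (1 - q * Z) * qPoch Z q⁻¹ k := by
  rw [qPoch, Finset.prod_range_succ', pow_zero, mul_one, mul_comm]
  congr 1
  refine Finset.prod_congr rfl fun j _ => ?_
  rw [pow_succ]
  field_simp

theorem qPoch_pow_inv_eq_zero (hq0 : 0 < q) {N k : ℕ} (h : N < k) :
    qPoch (q ^ N) q⁻¹ k = 0 := by
  refine Finset.prod_eq_zero (Finset.mem_range.mpr h) ?_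
  rw [← mul_pow, mul_inv_cancel₀ hq0.ne', one_pow, sub_self]

theorem qPoch_pow_inv_factor_mem (hq0 : 0 < q) (hq1 : q < 1) {N j : ℕ} (h : j ≤ N) :
    0 ≤ 1 - q ^ N * q⁻¹ ^ j ∧ 1 - q ^ N * q⁻¹ ^ j ≤ 1 := by
  have h1 : q ^ N * q⁻¹ ^ j = q ^ (N - j) := by
    rw [pow_sub₀ _ hq0.ne' h, inv_pow]
  rw [h1]
  have h2 : q ^ (N - j) ≤ 1 := pow_le_one₀ hq0.le hq1.le
  have h3 : 0 < q ^ (N - j) := pow_pos hq0 _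
  constructor <;> linarith

/-- In base q⁻¹ the factors are 1 - q^(N-j), which lie in [0, 1] for j ≤ N. The one with j = N
vanishes, which cuts the series off at degree N. -/
theorem qPoch_pow_inv_mem (hq0 : 0 < q) (hq1 : q < 1) (N k : ℕ) :
    0 ≤ qPoch (q ^ N) q⁻¹ k ∧ qPoch (q ^ N) q⁻¹ k ≤ 1 := by
  rcases lt_or_ge N k with h | h
  · rw [qPoch_pow_inv_eq_zero hq0 h]
    norm_num
  · have hj : ∀ j ∈ Finset.range k, j ≤ N := fun j hj => by
      have := Finset.mem_range.mp hj
      omega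
    exact ⟨Finset.prod_nonneg fun j hj' => (qPoch_pow_inv_factor_mem hq0 hq1 (hj j hj')).1,
      Finset.prod_le_one (fun j hj' => (qPoch_pow_inv_factor_mem hq0 hq1 (hj j hj')).1)
        fun j hj' => (qPoch_pow_inv_factor_mem hq0 hq1 (hj j hj')).2⟩

theorem tendsto_qPoch_pow_inv (hq0 : 0 < q) (hq1 : q < 1) (k : ℕ) :
    Tendsto (fun N : ℕ => qPoch (q ^ N) q⁻¹ k) atTop (𝓝 1) := by
  have : Tendsto (fun N : ℕ => ∏ j ∈ Finset.range k, (1 - q ^ N * q⁻¹ ^ j)) atTop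
      (𝓝 (∏ j ∈ Finset.range k, (1 - 0 * q⁻¹ ^ j))) :=
    tendsto_finsetProd _ fun j _ =>
      ((tendsto_pow_atTop_nhds_zero_of_lt_one hq0.le hq1).mul_const _).const_sub 1
  simpa [qPoch] using this

/-- The absolute values of the coefficients of the `q`-Bessel function as a series in `(z/2)^2`. -/
def coef (ν q : ℝ) (n : ℕ) : ℝ :=
  q ^ ((n : ℝ) * ((n : ℝ) + ν)) / (qPoch q q n * qPoch (q ^ (ν + 1)) q n)

theorem rpow_mem (hν : -1 < ν) (hq0 : 0 < q) (hq1 : q < 1) :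
    0 < q ^ (ν + 1) ∧ q ^ (ν + 1) < 1 :=
  ⟨Real.rpow_pos_of_pos hq0 _, Real.rpow_lt_one hq0.le hq1 (by linarith)⟩

theorem coef_pos (hν : -1 < ν) (hq0 : 0 < q) (hq1 : q < 1) (n : ℕ) : 0 < coef ν q n := by
  obtain ⟨h0, h1⟩ := rpow_mem hν hq0 hq1
  exact div_pos (Real.rpow_pos_of_pos hq0 _)
    (mul_pos (qPoch_pos hq0 hq1 hq0 hq1 n) (qPoch_pos hq0 hq1 h0 h1 n))

theorem coef_zero : coef ν q 0 = 1 := by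
  simp [coef, qPoch_zero]

theorem coef_succ (hν : -1 < ν) (hq0 : 0 < q) (hq1 : q < 1) (n : ℕ) :
    coef ν q (n + 1) * ((1 - q ^ (n + 1)) * (1 - q ^ (ν + 1) * q ^ n)) =
      coef ν q n * (q ^ (ν + 1) * q ^ (2 * n)) := by
  obtain ⟨h0, h1⟩ := rpow_mem hν hq0 hq1
  have hp : q ^ (((n + 1 : ℕ) : ℝ) * (((n + 1 : ℕ) : ℝ) + ν)) =
      q ^ ((n : ℝ) * ((n : ℝ) + ν)) * (q ^ (ν + 1) * q ^ (2 * n)) := by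
    rw [← Real.rpow_natCast q (2 * n), ← Real.rpow_add hq0, ← Real.rpow_add hq0]
    congr 1
    push_cast
    ring
  have h2 := (qPoch_pos hq0 hq1 hq0 hq1 n).ne'
  have h3 := (qPoch_pos hq0 hq1 h0 h1 n).ne'
  have h4 := (qPoch_pos hq0 hq1 hq0 hq1 (n + 1)).ne'
  have h5 := (qPoch_pos hq0 hq1 h0 h1 (n + 1)).ne'
  have h6 := qPoch_succ q q n
  have h7 := qPoch_succ (q ^ (ν + 1)) q n
  rw [coef, coef, hp, div_mul_eq_mul_div, div_mul_eq_mul_div, div_eq_div_iff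
    (mul_ne_zero h4 h5) (mul_ne_zero h2 h3), h6, h7, pow_succ']
  ring

theorem one_sub_pow_pos (hq0 : 0 < q) (hq1 : q < 1) {x : ℝ} (hx0 : 0 < x) (hx1 : x < 1) (n : ℕ) :
    0 < 1 - x * q ^ n := by
  have h1 : q ^ n ≤ 1 := pow_le_one₀ hq0.le hq1.le
  have h2 : 0 < q ^ n := pow_pos hq0 n
  nlinarith

/-- By `coef_succ` the ratio of coefficients is of order q^(2k), which beats the factor k + 1. -/
theorem tendsto_coef_ratio (hν : -1 < ν) (hq0 : 0 < q) (hq1 : q < 1) :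
    Tendsto (fun k : ℕ => ((k : ℝ) + 1) * (coef ν q (k + 1) / coef ν q k)) atTop (𝓝 0) := by
  obtain ⟨h0, h1⟩ := rpow_mem hν hq0 hq1
  have hq2 : q ^ 2 < 1 := by nlinarith
  have hpow : Tendsto (fun k : ℕ => q ^ k) atTop (𝓝 0) :=
    tendsto_pow_atTop_nhds_zero_of_lt_one hq0.le hq1
  have e1 : Tendsto (fun k : ℕ => (k : ℝ) * (q ^ 2) ^ k + (q ^ 2) ^ k) atTop (𝓝 (0 + 0)) :=
    (tendsto_self_mul_const_pow_of_lt_one (by positivity) hq2).add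
      (tendsto_pow_atTop_nhds_zero_of_lt_one (by positivity) hq2)
  have e2 : Tendsto (fun k : ℕ => (1 - q * q ^ k) * (1 - q ^ (ν + 1) * q ^ k)) atTop
      (𝓝 ((1 - q * 0) * (1 - q ^ (ν + 1) * 0))) :=
    ((hpow.const_mul q).const_sub 1).mul ((hpow.const_mul _).const_sub 1)
  have e3 := (e1.const_mul (q ^ (ν + 1))).div e2 (by norm_num)
  simp only [add_zero, mul_zero, zero_div] at e3
  refine e3.congr fun k => ?_
  have hk := coef_succ hν hq0 hq1 k
  have hc := (coef_pos hν hq0 hq1 k).ne'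
  have d1 := (one_sub_pow_pos hq0 hq1 hq0 hq1 k).ne'
  have d2 := (one_sub_pow_pos hq0 hq1 h0 h1 k).ne'
  simp only [Pi.div_apply]
  rw [mul_div_assoc', div_eq_div_iff (mul_ne_zero d1 d2) hc, ← pow_mul]
  rw [pow_succ'] at hk
  linear_combination -((k : ℝ) + 1) * hk

/-- The polynomials (`q`-Laguerre polynomials, suitably normalized) approximating the series. -/
def qLaguerre (ν q : ℝ) (N : ℕ) : ℝ[X] :=
  ∑ k ∈ Finset.range (N + 1), C ((-1) ^ k * qPoch (q ^ N) q⁻¹ k * coef ν q k) * X ^ k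

theorem coeff_qLaguerre (hq0 : 0 < q) (N k : ℕ) :
    (qLaguerre ν q N).coeff k = (-1) ^ k * qPoch (q ^ N) q⁻¹ k * coef ν q k := by
  rw [qLaguerre, finsetSum_coeff]
  simp only [coeff_C_mul, coeff_X_pow]
  rcases lt_or_ge k (N + 1) with h | h
  · rw [Finset.sum_eq_single k]
    · simp
    · intro j _ hj
      simp [hj.symm]
    · intro hk
      exact absurd (Finset.mem_range.mpr h) hk
  · rw [qPoch_pow_inv_eq_zero hq0 (by omega), mul_zero, zero_mul]
    refine Finset.sum_eq_zero fun j hj => ?_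
    have := Finset.mem_range.mp hj
    rw [if_neg (by omega), mul_zero]

/-- The three-term recurrence of the `q`-Laguerre polynomials. -/
theorem qLaguerre_recurrence (hν : -1 < ν) (hq0 : 0 < q) (hq1 : q < 1) (m : ℕ) :
    C (1 - q ^ (ν + 1) * q ^ (m + 1)) * qLaguerre ν q (m + 2) =
      C (1 - q * q ^ (m + 1) + q - q ^ (ν + 1) * q ^ (m + 1)) * qLaguerre ν q (m + 1) -
        C (q ^ (ν + 1) * (q ^ (m + 1)) ^ 2) * (X * qLaguerre ν q (m + 1)) -
        C (q * (1 - q ^ (m + 1))) * qLaguerre ν q m := by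
  ext k
  simp only [coeff_sub, coeff_C_mul, coeff_qLaguerre hq0]
  rcases k with _ | k
  · simp [coeff_qLaguerre hq0, qPoch_zero, coef_zero]
    ring
  · rw [coeff_X_mul, coeff_qLaguerre hq0]
    -- The three shifted factorials are related to the common one τ, and the two coefficients by
    -- `coef_succ`. With W = q^(m+1) q^(-k), what remains is the polynomial identity `e9`.
    have e1 : qPoch (q ^ (m + 2)) q⁻¹ (k + 1) =
        (1 - q * q ^ (m + 1)) * qPoch (q ^ (m + 1)) q⁻¹ k := by
      rw [← qPoch_inv_succ hq0, ← pow_succ']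
    have e2 := qPoch_succ (q ^ (m + 1)) q⁻¹ k
    have e3 : (1 - q ^ (m + 1)) * qPoch (q ^ m) q⁻¹ (k + 1) =
        qPoch (q ^ (m + 1)) q⁻¹ k * (1 - q ^ (m + 1) * q⁻¹ ^ k) *
          (1 - q ^ (m + 1) * q⁻¹ ^ (k + 1)) := by
      rw [← qPoch_succ, ← qPoch_succ, pow_succ' q m, ← qPoch_inv_succ hq0]
    have e4 := coef_succ hν hq0 hq1 k
    have e5 : q ^ k * q⁻¹ ^ k = 1 := by rw [← mul_pow, mul_inv_cancel₀ hq0.ne', one_pow]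
    have e6 : q * q⁻¹ = 1 := mul_inv_cancel₀ hq0.ne'
    rw [e1, e2]
    rw [pow_succ q⁻¹ k] at e3
    rw [pow_succ' q k, pow_mul'] at e4
    generalize qPoch (q ^ m) q⁻¹ (k + 1) = τ' at *
    generalize qPoch (q ^ (m + 1)) q⁻¹ k = τ at *
    generalize coef ν q (k + 1) = c1 at *
    generalize coef ν q k = c0 at *
    generalize q ^ (ν + 1) = A at *
    obtain ⟨W, hW⟩ : ∃ W, q ^ (m + 1) * q⁻¹ ^ k = W := ⟨_, rfl⟩
    have hZ : q ^ (m + 1) = W * q ^ k := by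
      rw [← hW]
      linear_combination (-q ^ (m + 1)) * e5
    rw [← mul_assoc, hW] at e3
    rw [hW]
    have e7 : A * (q ^ (m + 1)) ^ 2 * c0 = W ^ 2 * (c1 * ((1 - q * q ^ k) * (1 - A * q ^ k))) := by
      rw [hZ]
      linear_combination (-W ^ 2) * e4
    have e8 : q * ((1 - q ^ (m + 1)) * τ') = τ * (1 - W) * (q - W) := by
      rw [e3]
      linear_combination (-τ * (1 - W) * W) * e6
    rw [pow_succ (-1 : ℝ) k]
    generalize (-1 : ℝ) ^ k = σ at *
    have e9 : c1 * τ * ((1 - A * q ^ (m + 1)) * (1 - q * q ^ (m + 1))) =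
        c1 * τ * ((1 - q * q ^ (m + 1) + q - A * q ^ (m + 1)) * (1 - W) +
          W ^ 2 * ((1 - q * q ^ k) * (1 - A * q ^ k)) - (1 - W) * (q - W)) := by
      rw [hZ]
      ring
    linear_combination (-σ) * e9 + (σ * τ) * e7 - σ * c1 * e8

theorem qLaguerre_zero : qLaguerre ν q 0 = 1 := by
  simp [qLaguerre, qPoch_zero, coef_zero]

theorem qLaguerre_one (hν : -1 < ν) (hq0 : 0 < q) (hq1 : q < 1) :
    C (1 - q ^ (ν + 1)) * qLaguerre ν q 1 = C (1 - q ^ (ν + 1)) - C (q ^ (ν + 1)) * X := by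
  have e := coef_succ hν hq0 hq1 0
  simp only [zero_add, pow_one, pow_zero, mul_one, mul_zero, coef_zero, one_mul] at e
  have e1 : C (1 - q ^ (ν + 1)) * C (-(1 - q) * coef ν q 1) = C (-q ^ (ν + 1)) := by
    rw [← C_mul]
    congr 1
    linear_combination -e
  simp only [qLaguerre, Finset.sum_range_succ, Finset.sum_range_zero, qPoch_succ, qPoch_zero,
    coef_zero]
  have e2 : (-1 : ℝ) ^ 1 * (1 * (1 - q ^ 1 * q⁻¹ ^ 0)) * coef ν q 1 = -(1 - q) * coef ν q 1 := by
    ring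
  rw [e2, mul_add, pow_one, ← mul_assoc _ _ X, e1]
  simp
  ring

/-- A Christoffel-Darboux argument: by the recurrence, Im z · Im(P_(n+1) · conj P_n) is a positive
multiple of its predecessor minus a nonnegative multiple of |P_(n+1)|². So it stays negative, and no
P_n vanishes. -/
theorem aeval_qLaguerre_ne_zero_of_im_ne_zero (hν : -1 < ν) (hq0 : 0 < q) (hq1 : q < 1) {z : ℂ}
    (hz : z.im ≠ 0) (N : ℕ) : aeval z (qLaguerre ν q N) ≠ 0 := by
  obtain ⟨h0, h1⟩ := rpow_mem hν hq0 hq1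
  set P : ℕ → ℂ := fun n => aeval z (qLaguerre ν q n) with hP
  have hz2 : 0 < z.im ^ 2 := by positivity
  have hC : ∀ (r : ℝ) (p : ℝ[X]), aeval z (C r * p) = (r : ℂ) * aeval z p := fun r p => by
    rw [map_mul, aeval_C]
    rfl
  have hX : ∀ p : ℝ[X], aeval z (X * p) = z * aeval z p := fun p => by
    rw [map_mul, aeval_X]
  have hW : ∀ n, z.im * ((P (n + 1)).im * (P n).re - (P (n + 1)).re * (P n).im) < 0 := by
    intro n
    induction n with
    | zero =>
      have e0 : P 0 = 1 := by simp [hP, qLaguerre_zero]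
      have e1 : ((1 - q ^ (ν + 1) : ℝ) : ℂ) * P 1 =
          ((1 - q ^ (ν + 1) : ℝ) : ℂ) - ((q ^ (ν + 1) : ℝ) : ℂ) * z := by
        have := congrArg (aeval z) (qLaguerre_one hν hq0 hq1)
        rwa [map_sub (aeval (R := ℝ) z), hC, hC, aeval_X, aeval_C] at this
      have e2 := congrArg Complex.im e1
      rw [Complex.im_ofReal_mul, Complex.sub_im, Complex.ofReal_im, Complex.im_ofReal_mul] at e2
      rw [e0, zero_add, Complex.one_re, Complex.one_im]
      have e3 : (1 - q ^ (ν + 1)) * (z.im * (P 1).im) = -(q ^ (ν + 1) * z.im ^ 2) := by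
        linear_combination z.im * e2
      have e4 : 0 < q ^ (ν + 1) * z.im ^ 2 := mul_pos h0 hz2
      by_contra hcon
      have : 0 ≤ (1 - q ^ (ν + 1)) * (z.im * (P 1).im) :=
        mul_nonneg (by linarith) (by linarith)
      linarith
    | succ m ih =>
      have e1 := congrArg (aeval z) (qLaguerre_recurrence hν hq0 hq1 m)
      simp only [map_sub (aeval (R := ℝ) z), hC, hX] at e1
      change ((_ : ℝ) : ℂ) * P (m + 2) = ((_ : ℝ) : ℂ) * P (m + 1) -
        ((_ : ℝ) : ℂ) * (z * P (m + 1)) - ((_ : ℝ) : ℂ) * P m at e1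
      have e2 := congrArg Complex.im e1
      have e3 := congrArg Complex.re e1
      simp only [Complex.im_ofReal_mul, Complex.re_ofReal_mul, Complex.sub_im, Complex.sub_re,
        Complex.mul_im z, Complex.mul_re z] at e2 e3
      have d1 := one_sub_pow_pos hq0 hq1 h0 h1 (m + 1)
      have d3 : 0 < q * (1 - q ^ (m + 1)) := by
        have := one_sub_pow_pos hq0 hq1 hq0 hq1 m
        rw [pow_succ']
        exact mul_pos hq0 this
      have e4 : (1 - q ^ (ν + 1) * q ^ (m + 1)) *
          (z.im * ((P (m + 2)).im * (P (m + 1)).re - (P (m + 2)).re * (P (m + 1)).im)) =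
          -(q ^ (ν + 1) * (q ^ (m + 1)) ^ 2 * z.im ^ 2 *
            ((P (m + 1)).re ^ 2 + (P (m + 1)).im ^ 2)) +
          q * (1 - q ^ (m + 1)) *
            (z.im * ((P (m + 1)).im * (P m).re - (P (m + 1)).re * (P m).im)) := by
        linear_combination z.im * (P (m + 1)).re * e2 - z.im * (P (m + 1)).im * e3
      have d4 : 0 ≤ q ^ (ν + 1) * (q ^ (m + 1)) ^ 2 * z.im ^ 2 *
            ((P (m + 1)).re ^ 2 + (P (m + 1)).im ^ 2) := by positivity
      have d5 := mul_neg_of_pos_of_neg d3 ih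
      by_contra hcon
      have := mul_nonneg d1.le (not_lt.mp hcon)
      linarith
  intro hzero
  have := hW N
  have h2 : P N = 0 := hzero
  rw [h2] at this
  simp at this

/-- The signs (-1)^k are absorbed into (-x)^k, so no term is negative, and the constant term is 1.
-/
theorem eval_qLaguerre_pos (hν : -1 < ν) (hq0 : 0 < q) (hq1 : q < 1) {x : ℝ} (hx : x ≤ 0)
    (N : ℕ) : 0 < eval x (qLaguerre ν q N) := by
  have hterm : ∀ k, 0 ≤ qPoch (q ^ N) q⁻¹ k * coef ν q k * (-x) ^ k := fun k =>
    mul_nonneg (mul_nonneg (qPoch_pow_inv_mem hq0 hq1 N k).1 (coef_pos hν hq0 hq1 k).le)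
      (pow_nonneg (by linarith) k)
  have h1 : eval x (qLaguerre ν q N) =
      ∑ k ∈ Finset.range (N + 1), qPoch (q ^ N) q⁻¹ k * coef ν q k * (-x) ^ k := by
    rw [qLaguerre, eval_finsetSum]
    refine Finset.sum_congr rfl fun k _ => ?_
    rw [eval_mul, eval_C, eval_pow, eval_X, neg_pow x]
    ring
  rw [h1]
  have h2 := Finset.single_le_sum (fun k _ => hterm k)
    (Finset.mem_range.mpr (Nat.succ_pos N) : 0 ∈ Finset.range (N + 1))
  simp only [qPoch_zero, coef_zero, pow_zero, mul_one] at h2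
  linarith

theorem qLaguerre_eq_prod (hν : -1 < ν) (hq0 : 0 < q) (hq1 : q < 1) (N : ℕ) :
    ∃ (n : ℕ) (y : Fin n → ℝ), (∀ i, 0 < y i) ∧
      qLaguerre ν q N = ∏ i, (1 - C (y i) * X) := by
  refine exists_eq_prod_of_roots_pos _ ?_ fun z hz => ?_
  · rw [coeff_qLaguerre hq0, qPoch_zero, coef_zero]
    norm_num
  · have him : z.im = 0 := by
      by_contra him
      exact aeval_qLaguerre_ne_zero_of_im_ne_zero hν hq0 hq1 him N hz
    have hzr : z = (z.re : ℂ) := Complex.ext (Complex.ofReal_re _).symm (by simp [him])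
    refine ⟨z.re, ?_, hzr⟩
    by_contra hre
    have h1 := eval_qLaguerre_pos hν hq0 hq1 (not_lt.mp hre) N
    rw [hzr] at hz
    have h2 : aeval (algebraMap ℝ ℂ z.re) (qLaguerre ν q N) = 0 := hz
    rw [aeval_algebraMap_apply] at h2
    have h3 : aeval z.re (qLaguerre ν q N) = 0 := by simpa using h2
    rw [coe_aeval_eq_eval] at h3
    linarith

theorem isLimit_coef (hν : -1 < ν) (hq0 : 0 < q) (hq1 : q < 1) :
    IsLimit (coef ν q) (fun N k => qPoch (q ^ N) q⁻¹ k) (qLaguerre ν q) where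
  zero := coef_zero
  pos := coef_pos hν hq0 hq1
  ratio := tendsto_coef_ratio hν hq0 hq1
  abs_le N k := by
    rw [abs_of_nonneg (qPoch_pow_inv_mem hq0 hq1 N k).1]
    exact (qPoch_pow_inv_mem hq0 hq1 N k).2
  tendsto := tendsto_qPoch_pow_inv hq0 hq1
  coeff := coeff_qLaguerre hq0
  prod := qLaguerre_eq_prod hν hq0 hq1

/-- This is the series H. Positivity of the roots comes from `roots_pos_add_two_mul`, and the decay
from that of `coef` because (2k+3)/(2k+1) ≤ 3. -/
theorem isLimit_two_mul_add_one_mul_coef (hν : -1 < ν) (hq0 : 0 < q) (hq1 : q < 1) :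
    IsLimit (fun k => (2 * (k : ℝ) + 1) * coef ν q k) (fun N k => qPoch (q ^ N) q⁻¹ k)
      (fun N => qLaguerre ν q N + 2 * (X * derivative (qLaguerre ν q N))) where
  zero := by simp [coef_zero]
  pos k := mul_pos (by positivity) (coef_pos hν hq0 hq1 k)
  ratio := by
    have h3 := (tendsto_coef_ratio hν hq0 hq1).const_mul 3
    rw [mul_zero] at h3
    refine squeeze_zero (fun k => ?_) (fun k => ?_) h3
    · have := coef_pos hν hq0 hq1 k
      have := coef_pos hν hq0 hq1 (k + 1)
      positivity
    · have h4 := coef_pos hν hq0 hq1 k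
      have h5 := coef_pos hν hq0 hq1 (k + 1)
      have h6 : (2 * ((k + 1 : ℕ) : ℝ) + 1) / (2 * (k : ℝ) + 1) ≤ 3 := by
        rw [div_le_iff₀ (by positivity)]
        push_cast
        linarith [(Nat.cast_nonneg k : (0 : ℝ) ≤ k)]
      have h7 : 0 ≤ ((k : ℝ) + 1) * (coef ν q (k + 1) / coef ν q k) := by positivity
      rw [mul_div_mul_comm]
      calc _ = (2 * ((k + 1 : ℕ) : ℝ) + 1) / (2 * (k : ℝ) + 1) *
            (((k : ℝ) + 1) * (coef ν q (k + 1) / coef ν q k)) := by ring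
        _ ≤ _ := mul_le_mul_of_nonneg_right h6 h7
  abs_le := (isLimit_coef hν hq0 hq1).abs_le
  tendsto := (isLimit_coef hν hq0 hq1).tendsto
  coeff N k := by
    have h1 := (isLimit_coef hν hq0 hq1).coeff_X_mul_derivative N k
    have h2 : (2 * (X * derivative (qLaguerre ν q N))).coeff k =
        2 * (X * derivative (qLaguerre ν q N)).coeff k := by
      rw [← coeff_C_mul]
      rfl
    rw [coeff_add, h2, h1, coeff_qLaguerre hq0]
    ring
  prod N := by
    obtain ⟨n, y, hy, hprod⟩ := qLaguerre_eq_prod hν hq0 hq1 N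
    refine exists_eq_prod_of_roots_pos _ ?_ fun z hz => ?_
    · rw [coeff_add, coeff_qLaguerre hq0, qPoch_zero, coef_zero, mul_coeff_zero, coeff_X_mul_zero]
      norm_num
    · rw [hprod] at hz
      exact roots_pos_add_two_mul y hy z hz

end QBessel

end

/-! ### The radius of starlikeness as a first zero -/

noncomputable section

namespace QBessel

open Polynomial Filter Topology RealRooted

variable {ν q : ℝ}

theorem qPochInf_ne_zero {x : ℝ} (hq0 : 0 < q) (hq1 : q < 1) (hx0 : 0 < x) (hx1 : x < 1) :
    qPochInf x q ≠ 0 := by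
  have h := tprod_one_add_ne_zero_of_summable (f := fun k : ℕ => -(x * q ^ k))
    (fun k => by
      have := one_sub_pow_pos hq0 hq1 hx0 hx1 k
      linarith)
    (((summable_geometric_of_lt_one hq0.le hq1).mul_left x).congr fun k => by
      rw [norm_neg, Real.norm_of_nonneg (by positivity)])
  simpa [qPochInf, sub_eq_add_neg] using h

/-- The coefficients of the numerator of `z g' / g`. -/
def coefNum (ν q : ℝ) (k : ℕ) : ℝ := (2 * (k : ℝ) + 1) * coef ν q k

theorem summable_alt {e : ℕ → ℝ} (h : ∀ R : ℝ, 0 ≤ R → Summable fun k => |e k| * R ^ k) (z : ℂ) :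
    Summable fun k : ℕ => (-1) ^ k * (e k : ℂ) * z ^ k := by
  refine Summable.of_norm ((h ‖z‖ (norm_nonneg z)).congr fun k => ?_)
  simp

theorem alt_coefNum (hν : -1 < ν) (hq0 : 0 < q) (hq1 : q < 1) (z : ℂ) :
    alt (coefNum ν q) z = alt (coef ν q) z + 2 * alt (fun k => (k : ℝ) * coef ν q k) z := by
  have h := isLimit_coef hν hq0 hq1
  rw [alt, alt, alt, ← tsum_mul_left, ← (summable_alt h.summable z).tsum_add
    ((summable_alt h.summable_nat_mul z).mul_left 2)]
  refine tsum_congr fun k => ?_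
  rw [coefNum]
  push_cast
  ring

theorem altReal_coefNum (hν : -1 < ν) (hq0 : 0 < q) (hq1 : q < 1) (x : ℝ) :
    altReal (coefNum ν q) x =
      altReal (coef ν q) x + 2 * altReal (fun k => (k : ℝ) * coef ν q k) x := by
  have h := alt_coefNum hν hq0 hq1 (x : ℂ)
  simp only [alt_ofReal] at h
  exact_mod_cast h

/-- The power series form of `g2`. -/
def gSeries (ν q : ℝ) (z : ℂ) : ℂ := z * alt (coef ν q) (z ^ 2 / 4)

theorem hasDerivAt_gSeries (hν : -1 < ν) (hq0 : 0 < q) (hq1 : q < 1) (z : ℂ) :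
    HasDerivAt (gSeries ν q) (alt (coefNum ν q) (z ^ 2 / 4)) z := by
  obtain ⟨D, hD, hzD⟩ := (isLimit_coef hν hq0 hq1).exists_hasDerivAt_alt (z ^ 2 / 4)
  have h1 : HasDerivAt (fun w : ℂ => w ^ 2 / 4) (2 * z / 4) z := by
    simpa using (hasDerivAt_pow 2 z).div_const 4
  have h2 := (hasDerivAt_id z).mul (hD.comp z h1)
  refine h2.congr_deriv ?_
  rw [alt_coefNum hν hq0 hq1, ← hzD]
  simp only [id, Function.comp]
  ring

theorem hasDerivAt_altReal_coef (hν : -1 < ν) (hq0 : 0 < q) (hq1 : q < 1) (x : ℝ) :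
    ∃ D, HasDerivAt (altReal (coef ν q)) D x ∧
      altReal (coefNum ν q) x = altReal (coef ν q) x + 2 * (x * D) := by
  obtain ⟨D, hD, hzD⟩ := (isLimit_coef hν hq0 hq1).exists_hasDerivAt_alt (x : ℂ)
  refine ⟨D.re, ?_, ?_⟩
  · have h : HasDerivAt (fun x : ℝ => (alt (coef ν q) (x : ℂ)).re) D.re x := hD.real_of_complex
    simpa only [alt_ofReal, Complex.ofReal_re] using h
  · rw [altReal_coefNum hν hq0 hq1]
    have h := congrArg Complex.re hzD
    rw [alt_ofReal, Complex.ofReal_re, Complex.re_ofReal_mul] at h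
    rw [h]

theorem J2_eq (ν q : ℝ) {z : ℂ} (hz : z ≠ 0) :
    J2 ν q z = ((qPochInf (q ^ (ν + 1)) q / qPochInf q q : ℝ) : ℂ) *
      ((z / 2) ^ (ν : ℂ) * alt (coef ν q) (z ^ 2 / 4)) := by
  rw [J2, alt]
  congr 1
  rw [← tsum_mul_left]
  refine tsum_congr fun n => ?_
  have h2 : z / 2 ≠ 0 := div_ne_zero hz two_ne_zero
  have h3 : (z / 2) ^ (2 * (n : ℂ)) = (z ^ 2 / 4) ^ n := by
    rw [show 2 * (n : ℂ) = ((2 * n : ℕ) : ℂ) by push_cast; ring, Complex.cpow_natCast, pow_mul]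
    congr 1
    ring
  rw [Complex.cpow_add _ _ h2, h3, coef]
  push_cast
  ring

theorem g2_eq (hν : -1 < ν) (hq0 : 0 < q) (hq1 : q < 1) : g2 ν q = gSeries ν q := by
  obtain ⟨h0, h1⟩ := rpow_mem hν hq0 hq1
  funext z
  rcases eq_or_ne z 0 with rfl | hz
  · rw [gSeries, zero_mul, g2]
    -- At z = 0 the convention 0^s = 0 for s ≠ 0 makes z^(1-ν) vanish. For ν = 1 that power is 0^0 =
    -- 1, and instead every term of `J2`, with exponent 2n + 1, vanishes.
    rcases eq_or_ne ν 1 with rfl | hν1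
    · have : J2 1 q 0 = 0 := by
        rw [J2]
        convert mul_zero _
        convert tsum_zero with n
        rw [zero_div, Complex.zero_cpow]
        · simp
        · exact_mod_cast (by omega : 2 * n + 1 ≠ 0)
      rw [this, mul_zero]
    · rw [Complex.zero_cpow]
      · simp
      · intro h
        exact hν1 (by exact_mod_cast (sub_eq_zero.mp h).symm)
  · have hc : c ν q * (qPochInf (q ^ (ν + 1)) q / qPochInf q q) = 1 := by
      have e1 := qPochInf_ne_zero hq0 hq1 hq0 hq1
      have e2 := qPochInf_ne_zero hq0 hq1 h0 h1
      rw [c]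
      field_simp
    have h2 : z / 2 ≠ 0 := div_ne_zero hz two_ne_zero
    have hpow : (((2 : ℝ) ^ ν : ℝ) : ℂ) * (z / 2) ^ (ν : ℂ) = z ^ (ν : ℂ) := by
      rw [Complex.ofReal_cpow zero_le_two, Complex.cpow_def_of_ne_zero (by norm_num),
        Complex.cpow_def_of_ne_zero h2, Complex.cpow_def_of_ne_zero hz, ← Complex.exp_add]
      have : Complex.log z = Complex.log ((2 : ℝ) : ℂ) + Complex.log (z / 2) := by
        rw [← Complex.ofReal_log zero_le_two, ← Complex.log_ofReal_mul zero_lt_two h2]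
        congr 1
        push_cast
        ring
      rw [this]
      congr 1
      ring
    have hz1 : z ^ (1 - (ν : ℂ)) * z ^ (ν : ℂ) = z := by
      rw [← Complex.cpow_add _ _ hz]
      simp
    have hc' : (c ν q : ℂ) * ((qPochInf (q ^ (ν + 1)) q / qPochInf q q : ℝ) : ℂ) = 1 := by
      exact_mod_cast hc
    rw [g2, J2_eq ν q hz, gSeries, Complex.ofReal_mul]
    calc _ = ((c ν q : ℂ) * ((qPochInf (q ^ (ν + 1)) q / qPochInf q q : ℝ) : ℂ)) *
          (z ^ (1 - (ν : ℂ)) * ((((2 : ℝ) ^ ν : ℝ) : ℂ) * (z / 2) ^ (ν : ℂ))) *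
          alt (coef ν q) (z ^ 2 / 4) := by ring
      _ = _ := by rw [hc', hpow, hz1, one_mul]

/-- For `r > 0` the equation `r J'(r) = (ν - 1) J(r)` says that the numerator series vanishes. -/
theorem equation_iff (hν : -1 < ν) (hq0 : 0 < q) (hq1 : q < 1) {r : ℝ} (hr : 0 < r) :
    (r : ℂ) * deriv (fun t : ℝ => J2 ν q (t : ℂ)) r - ((ν : ℂ) - 1) * J2 ν q (r : ℂ) = 0 ↔
      altReal (coefNum ν q) (r ^ 2 / 4) = 0 := by
  obtain ⟨h0, h1⟩ := rpow_mem hν hq0 hq1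
  set K := qPochInf (q ^ (ν + 1)) q / qPochInf q q with hK
  have hK0 : K ≠ 0 :=
    div_ne_zero (qPochInf_ne_zero hq0 hq1 h0 h1) (qPochInf_ne_zero hq0 hq1 hq0 hq1)
  have hJ : ∀ t : ℝ, 0 < t → J2 ν q (t : ℂ) =
      ((K * ((t / 2) ^ ν * altReal (coef ν q) (t ^ 2 / 4)) : ℝ) : ℂ) := by
    intro t ht
    rw [J2_eq ν q (by exact_mod_cast ht.ne'), ← hK]
    have e1 : ((t : ℂ) ^ 2 / 4) = ((t ^ 2 / 4 : ℝ) : ℂ) := by push_cast; rfl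
    have e2 : ((t : ℂ) / 2) ^ (ν : ℂ) = (((t / 2) ^ ν : ℝ) : ℂ) := by
      rw [Complex.ofReal_cpow (by positivity)]
      push_cast
      rfl
    rw [e1, e2, alt_ofReal]
    push_cast
    rfl
  obtain ⟨D, hD, hnum⟩ := hasDerivAt_altReal_coef hν hq0 hq1 (r ^ 2 / 4)
  have d1 : HasDerivAt (fun t : ℝ => t ^ 2 / 4) (2 * r / 4) r := by
    simpa using (hasDerivAt_pow 2 r).div_const 4
  have d2 : HasDerivAt (fun t : ℝ => (t / 2) ^ ν) (1 / 2 * ν * (r / 2) ^ (ν - 1)) r :=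
    ((hasDerivAt_id r).div_const 2).rpow_const (Or.inl (by simpa using hr.ne'))
  have d3 := (d2.mul (hD.comp r d1)).const_mul K
  have d4 := d3.ofReal_comp
  have hev : (fun t : ℝ => J2 ν q (t : ℂ)) =ᶠ[𝓝 r]
      fun t : ℝ => ((K * ((t / 2) ^ ν * altReal (coef ν q) (t ^ 2 / 4)) : ℝ) : ℂ) := by
    filter_upwards [lt_mem_nhds hr] with t ht using hJ t ht
  rw [(d4.congr_of_eventuallyEq hev).deriv, hJ r hr]
  have hpow : (r / 2) ^ ν = (r / 2) ^ (ν - 1) * (r / 2) := by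
    rw [← Real.rpow_add_one (by positivity)]
    congr 1
    ring
  have hval : r * (K * (1 / 2 * ν * (r / 2) ^ (ν - 1) * altReal (coef ν q) (r ^ 2 / 4) +
      (r / 2) ^ ν * (D * (2 * r / 4)))) -
      (ν - 1) * (K * ((r / 2) ^ ν * altReal (coef ν q) (r ^ 2 / 4))) =
      K * (r / 2) ^ ν * altReal (coefNum ν q) (r ^ 2 / 4) := by
    rw [hnum]
    rw [hpow]
    ring
  have hK1 : K * (r / 2) ^ ν ≠ 0 := mul_ne_zero hK0 (Real.rpow_pos_of_pos (by positivity) _).ne'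
  constructor
  · intro h
    have h' : r * (K * (1 / 2 * ν * (r / 2) ^ (ν - 1) * altReal (coef ν q) (r ^ 2 / 4) +
      (r / 2) ^ ν * (D * (2 * r / 4)))) -
      (ν - 1) * (K * ((r / 2) ^ ν * altReal (coef ν q) (r ^ 2 / 4))) = 0 := by
      exact_mod_cast h
    rw [hval] at h'
    exact (mul_eq_zero.mp h').resolve_left hK1
  · intro h
    rw [h, mul_zero] at hval
    exact_mod_cast hval

/-- The radius of starlikeness is `2 √h` where `h` is the smallest zero of the numerator series. -/
theorem radiusOfStarlikeness_g2_eq (hν : -1 < ν) (hq0 : 0 < q) (hq1 : q < 1) {h : ℝ} (hh : 0 < h)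
    (hzero : altReal (coefNum ν q) h = 0)
    (hpos : ∀ x, 0 ≤ x → x < h → 0 < altReal (coefNum ν q) x) :
    radiusOfStarlikeness (g2 ν q) = 2 * √h := by
  obtain ⟨k, hk, hkzero, hkpos, -, -, -, -, -, hkz⟩ := (isLimit_coef hν hq0 hq1).exists_first_zero
  have hsq : ∀ x : ℝ, 0 ≤ x → (2 * √x) ^ 2 / 4 = x := fun x hx => by
    rw [mul_pow, Real.sq_sqrt hx]
    ring
  have hderiv : ∀ t : ℝ, HasDerivAt (fun t : ℝ => t * altReal (coef ν q) (t ^ 2 / 4))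
      (altReal (coefNum ν q) (t ^ 2 / 4)) t := by
    intro t
    obtain ⟨D, hD, hnum⟩ := hasDerivAt_altReal_coef hν hq0 hq1 (t ^ 2 / 4)
    have d1 : HasDerivAt (fun t : ℝ => t ^ 2 / 4) (2 * t / 4) t := by
      simpa using (hasDerivAt_pow 2 t).div_const 4
    refine ((hasDerivAt_id t).mul (hD.comp t d1)).congr_deriv ?_
    rw [hnum]
    simp only [id, Function.comp]
    ring
  -- The real function t G(t²/4) has derivative H(t²/4) > 0 before 2√h. It increases from 0, so the
  -- first zero k of G lies beyond h.
  have hmono : StrictMonoOn (fun t : ℝ => t * altReal (coef ν q) (t ^ 2 / 4))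
      (Set.Icc 0 (2 * √h)) := by
    refine strictMonoOn_of_deriv_pos (convex_Icc _ _)
      (fun t _ => (hderiv t).continuousAt.continuousWithinAt) fun t ht => ?_
    rw [interior_Icc] at ht
    rw [(hderiv t).deriv]
    refine hpos _ (by positivity) ?_
    rw [← hsq h hh.le]
    have := pow_lt_pow_left₀ ht.2 ht.1.le two_ne_zero
    linarith
  have hhk : h < k := by
    by_contra hcon
    have hkh := not_lt.mp hcon
    have h1 : 0 < 2 * √k := by positivity
    have h2 := hmono (Set.left_mem_Icc.mpr (by positivity))
      (⟨h1.le, by have := Real.sqrt_le_sqrt hkh; linarith⟩ : 2 * √k ∈ Set.Icc 0 (2 * √h)) h1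
    simp [hsq k hk.le, hkzero] at h2
  rw [radiusOfStarlikeness, g2_eq hν hq0 hq1]
  have hset : {r : ℝ | 0 < r ∧ DifferentiableOn ℂ (gSeries ν q) (Metric.ball 0 r) ∧
      ∀ z ∈ Metric.ball (0 : ℂ) r, z ≠ 0 →
        0 < (z * deriv (gSeries ν q) z / gSeries ν q z).re} = Set.Ioc 0 (2 * √h) := by
    ext r
    constructor
    -- At 2√h the derivative of g vanishes, so no ball containing this point qualifies. The radius
    -- 2√h itself is admitted because balls are open.
    · rintro ⟨hr, -, hre⟩
      refine ⟨hr, ?_⟩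
      by_contra hcon
      have hs : 0 < 2 * √h := by positivity
      have h1 := hre ((2 * √h : ℝ) : ℂ)
        (by simpa [abs_of_pos hs, abs_of_nonneg (Real.sqrt_nonneg h)] using not_le.mp hcon)
        (by exact_mod_cast hs.ne')
      have e1 : (((2 * √h : ℝ) : ℂ) ^ 2 / 4) = (h : ℂ) := by
        exact_mod_cast congrArg Complex.ofReal (hsq h hh.le)
      rw [(hasDerivAt_gSeries hν hq0 hq1 _).deriv, e1, alt_ofReal, hzero] at h1
      simp at h1
    · rintro ⟨hr, hrh⟩
      refine ⟨hr, fun z _ => (hasDerivAt_gSeries hν hq0 hq1 z).differentiableAt.differentiableWithinAt,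
        fun z hz hz0 => ?_⟩
      have hzr : ‖z‖ < 2 * √h := lt_of_lt_of_le (by simpa using hz) hrh
      have hw : ‖z ^ 2 / 4‖ < h := by
        rw [← hsq h hh.le, norm_div, norm_pow]
        have := pow_lt_pow_left₀ hzr (norm_nonneg z) two_ne_zero
        simp only [Complex.norm_ofNat]
        linarith
      rw [(hasDerivAt_gSeries hν hq0 hq1 z).deriv, gSeries, mul_div_mul_left _ _ hz0]
      generalize z ^ 2 / 4 = w at *
      obtain ⟨h1, h2⟩ := hkz w (hw.trans hhk)
      have hG := hkpos _ (norm_nonneg w) (hw.trans hhk)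
      have hH := hpos _ (norm_nonneg w) hw
      have hne : alt (coef ν q) w ≠ 0 := norm_pos_iff.mp (lt_of_lt_of_le hG h1)
      rw [alt_coefNum hν hq0 hq1, add_div, div_self hne, mul_div_assoc, Complex.add_re,
        Complex.one_re]
      have h3 : ∀ u : ℂ, (2 * u).re = 2 * u.re := fun u => by simp
      rw [h3]
      rw [altReal_coefNum hν hq0 hq1] at hH
      have h4 : 0 < 1 + 2 * (altReal (fun k => (k : ℝ) * coef ν q k) ‖w‖ /
          altReal (coef ν q) ‖w‖) := by
        have := div_pos hH hG
        rwa [add_div, div_self hG.ne', mul_div_assoc] at this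
      linarith
  rw [hset]
  exact csSup_Ioc (by positivity)

end QBessel

end

/-! ### Explicit power sums -/

noncomputable section

namespace QBessel

open Polynomial Filter Topology RealRooted

variable {ν q : ℝ}

theorem rpow_add_nat (hq0 : 0 < q) (m : ℕ) : q ^ (ν + 1 + m) = q ^ (ν + 1) * q ^ m := by
  rw [Real.rpow_add hq0, Real.rpow_natCast]

theorem rpow_two_mul_add_nat (hq0 : 0 < q) (m : ℕ) :
    q ^ (2 * ν + 2 + m) = (q ^ (ν + 1)) ^ 2 * q ^ m := by
  rw [Real.rpow_add hq0, Real.rpow_natCast, ← Real.rpow_natCast (q ^ (ν + 1)) 2,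
    ← Real.rpow_mul hq0.le]
  congr 2
  push_cast
  ring

theorem rpow_two_mul_add_two (hq0 : 0 < q) : q ^ (2 * ν + 2) = (q ^ (ν + 1)) ^ 2 := by
  simpa using rpow_two_mul_add_nat (ν := ν) hq0 0

theorem rpow_add_two (hq0 : 0 < q) : q ^ (ν + 2) = q ^ (ν + 1) * q := by
  have := rpow_add_nat (ν := ν) hq0 1
  rw [pow_one] at this
  rw [← this]
  congr 1
  push_cast
  ring

theorem rpow_add_three (hq0 : 0 < q) : q ^ (ν + 3) = q ^ (ν + 1) * q ^ 2 := by
  rw [← rpow_add_nat hq0]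
  congr 1
  push_cast
  ring

/-- The numerator of (3c₁)² - 2(5c₂) = 9c₁² - 10c₂, up to the factor (q^(ν+1))². -/
theorem d_eq (hq0 : 0 < q) :
    d ν q = 9 * (1 + q) * (1 - q ^ (ν + 1) * q) - 10 * q ^ 2 * (1 - q ^ (ν + 1)) := by
  rw [d, rpow_add_two hq0, rpow_add_three hq0]
  ring

/-- A third of the numerator of 27c₁³ - 45c₁c₂ + 21c₃, up to the factor (q^(ν+1))³. -/
theorem a_add_b_eq (hq0 : 0 < q) :
    a ν q + b ν q = 9 * (1 + q) * (1 + q + q ^ 2) * (1 - q ^ (ν + 1) * q) *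
        (1 - q ^ (ν + 1) * q ^ 2) -
      15 * q ^ 2 * (1 - q ^ (ν + 1)) * (1 + q + q ^ 2) * (1 - q ^ (ν + 1) * q ^ 2) +
      7 * q ^ 6 * (1 - q ^ (ν + 1)) ^ 2 := by
  have h (x : ℝ) (m : ℕ) (hx : x = ν + 1 + m) : q ^ x = q ^ (ν + 1) * q ^ m := by
    rw [hx, rpow_add_nat hq0]
  have h' (x : ℝ) (m : ℕ) (hx : x = 2 * ν + 2 + m) : q ^ x = (q ^ (ν + 1)) ^ 2 * q ^ m := by
    rw [hx, rpow_two_mul_add_nat hq0]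
  rw [a, b, h (ν + 2) 1 (by push_cast; ring), h (ν + 3) 2 (by push_cast; ring),
    h (ν + 4) 3 (by push_cast; ring), h (ν + 5) 4 (by push_cast; ring),
    h (ν + 6) 5 (by push_cast; ring), h (ν + 7) 6 (by push_cast; ring),
    h' (2 * ν + 5) 3 (by push_cast; ring), h' (2 * ν + 6) 4 (by push_cast; ring),
    h' (2 * ν + 7) 5 (by push_cast; ring), h' (2 * ν + 8) 6 (by push_cast; ring)]
  ring

/-- The first three power sums of the reciprocals of the zeros of the numerator series. -/
theorem power_sums (hν : -1 < ν) (hq0 : 0 < q) (hq1 : q < 1) :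
    coefNum ν q 1 = 3 * q ^ (ν + 1) / ((1 - q) * (1 - q ^ (ν + 1))) ∧
    coefNum ν q 1 ^ 2 - 2 * coefNum ν q 2 = (q ^ (ν + 1)) ^ 2 * d ν q /
      ((1 - q) ^ 2 * (1 - q ^ (ν + 1)) ^ 2 * (1 + q) * (1 - q ^ (ν + 1) * q)) ∧
    coefNum ν q 1 ^ 3 - 3 * coefNum ν q 1 * coefNum ν q 2 + 3 * coefNum ν q 3 =
      3 * (q ^ (ν + 1)) ^ 3 * (a ν q + b ν q) /
      ((1 - q) ^ 3 * (1 - q ^ (ν + 1)) ^ 3 * (1 + q) * (1 + q + q ^ 2) *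
        (1 - q ^ (ν + 1) * q) * (1 - q ^ (ν + 1) * q ^ 2)) := by
  obtain ⟨h0, h1⟩ := rpow_mem hν hq0 hq1
  have s0 := coef_succ hν hq0 hq1 0
  have s1 := coef_succ hν hq0 hq1 1
  have s2 := coef_succ hν hq0 hq1 2
  have p1 := one_sub_pow_pos hq0 hq1 h0 h1 1
  have p2 := one_sub_pow_pos hq0 hq1 h0 h1 2
  rw [d_eq hq0, a_add_b_eq hq0]
  simp only [coefNum]
  norm_num [coef_zero] at s0 s1 s2 ⊢
  rw [pow_one] at p1
  generalize q ^ (ν + 1) = A at *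
  have n1 : 0 < 1 - q := by linarith
  have n2 : 0 < 1 - A := by linarith
  have n3 : 0 < 1 + q := by linarith
  have n4 : 0 < 1 + q + q ^ 2 := by positivity
  have c1 : coef ν q 1 = A / ((1 - q) * (1 - A)) := by
    rw [eq_div_iff (by positivity)]
    exact s0
  have c2 : coef ν q 2 = A ^ 2 * q ^ 2 / ((1 - q) ^ 2 * (1 + q) * (1 - A) * (1 - A * q)) := by
    rw [eq_div_iff (by positivity)]
    linear_combination (1 - q) * (1 - A) * s1 + A * q ^ 2 * s0
  have c3 : coef ν q 3 = A ^ 3 * q ^ 6 / ((1 - q) ^ 3 * (1 + q) * (1 + q + q ^ 2) * (1 - A) *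
      (1 - A * q) * (1 - A * q ^ 2)) := by
    have s2' := c2
    rw [eq_div_iff (by positivity)] at s2' ⊢
    linear_combination (1 - q) ^ 2 * (1 + q) * (1 - A) * (1 - A * q) * s2 + A * q ^ 4 * s2'
  rw [c1, c2, c3]
  refine ⟨?_, ?_, ?_⟩
  · field_simp
  · field_simp
    ring
  · field_simp
    ring

end QBessel

end

/-! ### Smallest root and bounds -/

theorem theorem2 (ν q : ℝ) (hν : -1 < ν) (hq0 : 0 < q) (hq1 : q < 1) :
    IsLeast {r : ℝ | 0 < r ∧
        (r : ℂ) * deriv (fun t : ℝ => QBessel.J2 ν q (t : ℂ)) r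
          - ((ν : ℂ) - 1) * QBessel.J2 ν q (r : ℂ) = 0}
      (QBessel.radiusOfStarlikeness (QBessel.g2 ν q)) ∧
    2 * √((q ^ (ν + 1) - 1) * (q - 1) / (3 * q ^ (ν + 1)))
      < QBessel.radiusOfStarlikeness (QBessel.g2 ν q) ∧
    QBessel.radiusOfStarlikeness (QBessel.g2 ν q)
      < 2 * √(3 * (q ^ (ν + 1) - 1) * (q ^ (ν + 2) - 1) * (1 - q ^ 2)
          / (q ^ (ν + 1) * QBessel.d ν q)) ∧
    2 * ((q ^ (ν + 1) - 1) ^ 2 * (1 - q ^ (ν + 2)) * (q - 1) ^ 2 * (q + 1)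
          / (q ^ (2 * ν + 2) * QBessel.d ν q)) ^ (1 / 4 : ℝ)
      < QBessel.radiusOfStarlikeness (QBessel.g2 ν q) ∧
    QBessel.radiusOfStarlikeness (QBessel.g2 ν q)
      < 2 / 3 * √(3 * (1 - q ^ (ν + 1)) * (q ^ (ν + 3) - 1) * (q - 1)
          / ((q + 1) * q ^ (ν + 1)) * QBessel.q1star ν q) := by
  obtain ⟨h, hh, hzero, hpos, b1, b2, b3, b4, b5, -⟩ :=
    (QBessel.isLimit_two_mul_add_one_mul_coef hν hq0 hq1).exists_first_zero
  rw [QBessel.radiusOfStarlikeness_g2_eq hν hq0 hq1 hh hzero hpos]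
  have hsq : (2 * √h) ^ 2 / 4 = h := by
    rw [mul_pow, Real.sq_sqrt hh.le]
    ring
  refine ⟨⟨⟨by positivity, ?_⟩, ?_⟩, ?_⟩
  · rw [QBessel.equation_iff hν hq0 hq1 (by positivity), hsq]
    exact hzero
  · rintro r ⟨hr, heq⟩
    rw [QBessel.equation_iff hν hq0 hq1 hr] at heq
    by_contra hcon
    refine (hpos (r ^ 2 / 4) (by positivity) ?_).ne' heq
    rw [← hsq]
    have := pow_lt_pow_left₀ (not_le.mp hcon) hr.le two_ne_zero
    linarith
  obtain ⟨h0, h1⟩ := QBessel.rpow_mem hν hq0 hq1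
  have p1 := QBessel.one_sub_pow_pos hq0 hq1 h0 h1 1
  have p2 := QBessel.one_sub_pow_pos hq0 hq1 h0 h1 2
  obtain ⟨s1, s2, s3⟩ := QBessel.power_sums hν hq0 hq1
  change 1 < h * QBessel.coefNum ν q 1 at b1
  change 1 < h ^ 2 * (QBessel.coefNum ν q 1 ^ 2 - 2 * QBessel.coefNum ν q 2) at b2
  change h * (QBessel.coefNum ν q 1 ^ 2 - 2 * QBessel.coefNum ν q 2) <
    QBessel.coefNum ν q 1 at b3
  change h * (QBessel.coefNum ν q 1 ^ 3 - 3 * QBessel.coefNum ν q 1 * QBessel.coefNum ν q 2 +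
    3 * QBessel.coefNum ν q 3) <
    QBessel.coefNum ν q 1 ^ 2 - 2 * QBessel.coefNum ν q 2 at b4
  change 0 < QBessel.coefNum ν q 1 ^ 3 - 3 * QBessel.coefNum ν q 1 * QBessel.coefNum ν q 2 +
    3 * QBessel.coefNum ν q 3 at b5
  rw [s3] at b4 b5
  rw [s2] at b2 b3 b4
  rw [s1] at b1 b3
  rw [QBessel.q1star, QBessel.rpow_add_two hq0, QBessel.rpow_add_three hq0,
    QBessel.rpow_two_mul_add_two hq0]
  rw [pow_one] at p1
  generalize q ^ (ν + 1) = A at *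
  generalize QBessel.d ν q = D at *
  generalize QBessel.a ν q + QBessel.b ν q = S at *
  have n1 : 0 < 1 - q := by linarith
  have n2 : 0 < 1 - A := by linarith
  have n3 : 0 < 1 + q := by linarith
  have n4 : 0 < 1 + q + q ^ 2 := by positivity
  -- The signs of D and S are read off from the power sums, which are already known to be positive.
  have hD : 0 < D := by
    by_contra hcon
    have : A ^ 2 * D / ((1 - q) ^ 2 * (1 - A) ^ 2 * (1 + q) * (1 - A * q)) ≤ 0 :=
      div_nonpos_of_nonpos_of_nonneg
        (mul_nonpos_of_nonneg_of_nonpos (by positivity) (not_lt.mp hcon)) (by positivity)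
    have := mul_nonpos_of_nonneg_of_nonpos (sq_nonneg h) this
    linarith
  have hS : 0 < S := by
    by_contra hcon
    have : 3 * A ^ 3 * S / ((1 - q) ^ 3 * (1 - A) ^ 3 * (1 + q) * (1 + q + q ^ 2) *
        (1 - A * q) * (1 - A * q ^ 2)) ≤ 0 :=
      div_nonpos_of_nonpos_of_nonneg
        (mul_nonpos_of_nonneg_of_nonpos (by positivity) (not_lt.mp hcon)) (by positivity)
    linarith
  refine ⟨?_, ?_, ?_, ?_⟩
  · have e : (A - 1) * (q - 1) / (3 * A) = (1 - A) * (1 - q) / (3 * A) := by ring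
    rw [e]
    refine mul_lt_mul_of_pos_left (Real.sqrt_lt_sqrt (by positivity) ?_) two_pos
    rw [div_lt_iff₀ (by positivity)]
    rw [mul_div_assoc', lt_div_iff₀ (by positivity)] at b1
    linarith
  · have e : 3 * (A - 1) * (A * q - 1) * (1 - q ^ 2) / (A * D) =
        3 * (1 - A) * (1 - A * q) * ((1 - q) * (1 + q)) / (A * D) := by ring
    rw [e]
    refine mul_lt_mul_of_pos_left (Real.sqrt_lt_sqrt hh.le ?_) two_pos
    rw [lt_div_iff₀ (by positivity)]
    rw [mul_div_assoc', div_lt_div_iff₀ (by positivity) (by positivity)] at b3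
    -- The common factor that the two closed forms of the power sums leave uncancelled.
    have hc : 0 < A * (1 - q) * (1 - A) := by positivity
    refine lt_of_mul_lt_mul_left ?_ hc.le
    linarith
  · have e : (A - 1) ^ 2 * (1 - A * q) * (q - 1) ^ 2 * (q + 1) / (A ^ 2 * D) =
        (1 - A) ^ 2 * (1 - A * q) * (1 - q) ^ 2 * (1 + q) / (A ^ 2 * D) := by ring
    have e2 : √h = (h ^ 2) ^ (1 / 4 : ℝ) := by
      rw [Real.sqrt_eq_rpow, ← Real.rpow_natCast h 2, ← Real.rpow_mul hh.le]
      norm_num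
    rw [e, e2]
    refine mul_lt_mul_of_pos_left (Real.rpow_lt_rpow (by positivity) ?_ (by norm_num)) two_pos
    rw [div_lt_iff₀ (by positivity)]
    rw [mul_div_assoc', lt_div_iff₀ (by positivity)] at b2
    linarith
  -- The cubic is (q+1)(q²+q+1), and a factor 3² is taken out of the root to turn 2/3 into 2.
  · have e : 3 * (1 - A) * (A * q ^ 2 - 1) * (q - 1) / ((q + 1) * A) *
        ((q ^ 3 + 2 * q ^ 2 + 2 * q + 1) * D / S) =
        3 ^ 2 * ((1 - A) * (1 - A * q ^ 2) * (1 - q) * (1 + q + q ^ 2) * D / (3 * A * S)) := by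
      field_simp
      ring
    rw [e, Real.sqrt_mul (by positivity), Real.sqrt_sq (by norm_num), ← mul_assoc,
      div_mul_cancel₀ _ (by norm_num)]
    refine mul_lt_mul_of_pos_left (Real.sqrt_lt_sqrt hh.le ?_) two_pos
    rw [lt_div_iff₀ (by positivity)]
    rw [mul_div_assoc', div_lt_div_iff₀ (by positivity) (by positivity)] at b4
    have hc : 0 < A ^ 2 * (1 - q) ^ 2 * (1 - A) ^ 2 * (1 + q) * (1 - A * q) := by positivity
    refine lt_of_mul_lt_mul_left ?_ hc.le
    linarith
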